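/- Let $n\in\mathbb N$, let $m_0,\dots,m_n\ge 1$ be integers, let $\mathfrak A=\bigoplus_{l=0}^n M_{m_l}(\mathbb C)$ with its C*-norm, and let $m_{\mathfrak A}=\max_l m_l$. For $a=(a^l_{j,k})\in\mathfrak A$ put $\|a\|_{\infty,\mathfrak A_{\mathbb R}}=\max_{l,j,k}\max\{|\operatorname{Re}a^l_{j,k}|,|\operatorname{Im}a^l_{j,k}|\}$. For a (nonempty) compact metric space $(X,d_X)$ and a self-adjoint $a\in C(X,\mathfrak A)$ let $$\mathsf L_X(a)=\max\Big\{\sup_{x\ne y}\frac{\|a(x)-a(y)\|_{\infty,\mathfrak A_{\mathbb R}}}{d_X(x,y)},\ \inf_{r\in\mathbb R}\sup_{x\in X}\|a(x)-r1_{\mathfrak A}\|_{\infty,\mathfrak A_{\mathbb R}}\Big\}\in[0,\infty].$$ Definitions. A compact quantum metric space $(\mathfrak B,\mathsf L)$ is a nonzero unital C*-algebra $\mathfrak B$ with a lower semicontinuous $[0,\infty]$-valued real seminorm $\mathsf L$ on its self-adjoint part $\mathfrak{sa}(\mathfrak B)$, finite on a dense subspace, with $\{\mathsf L=0\}=\mathbb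 R1$, such that $\mathsf{mk}_{\mathsf L}(\varphi,\psi)=\sup\{|\varphi(a)-\psi(a)|:a\in\mathfrak{sa}(\mathfrak B),\ \mathsf L(a)\le1\}$ metrizes the weak* topology of the state space $\mathscr S(\mathfrak B)$. It is $(C,D)$-quasi-Leibniz, for $C\ge1$, $D\ge0$, if $\max\{\mathsf L(\frac{ab+ba}2),\mathsf L(\frac{ab-ba}{2i})\}\le C(\|a\|\mathsf L(b)+\|b\|\mathsf L(a))+D\,\mathsf L(a)\mathsf L(b)$ whenever $\mathsf L(a),\mathsf L(b)<\infty$; $\mathrm{qLCQMS}$ is the class of all such spaces, for all $C,D$. Two of them are quantum isometric if there is a *-isomorphism $\pi$ with $\mathsf L_2\circ\pi=\mathsf L_1$. A bridge from $\mathfrak B_1$ to $\mathfrak B_2$ is a tuple $\gamma=(\mathfrak D,\omega,\rho_1,\rho_2)$ of a unital C*-algebra $\mathfrak D$, unital *-monomorphisms $\rho_i:\mathfrak B_i\to\mathfrak D$, and $\omega\in\mathfrak D$ such that $\mathscr S_1(\omega)=\{\varphi\in\mathscr S(\mathfrak D):\varphi((1-\omega)^*(1-\omega))=\varphi((1-\omega)(1-\omega)^*)=0\}$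 is nonempty. Its length is the maximum of its reach, the Hausdorff distance in $\mathfrak D$ between $\{\rho_1(a)\omega:\mathsf L_1(a)\le1\}$ and $\{\omega\rho_2(b):\mathsf L_2(b)\le1\}$, and its height, the larger of the Hausdorff distances for $\mathsf{mk}_{\mathsf L_i}$ between $\mathscr S(\mathfrak B_i)$ and $\{\varphi\circ\rho_i:\varphi\in\mathscr S_1(\omega)\}$, $i=1,2$. The quantum Gromov–Hausdorff propinquity $\Lambda$ between two elements of $\mathrm{qLCQMS}$ is the infimum, over all finite chains of bridges joining them through elements of $\mathrm{qLCQMS}$, of the sum of the lengths of the bridges. Let $\mathrm{GH}$ be the Gromov–Hausdorff distance. Theorem. For every compact metric space $X$, $(C(X,\mathfrak A),\mathsf L_X)$ is a $(\sqrt2\,m_{\mathfrak A},0)$-quasi-Leibniz compact quantum metric space. The map $$\Gamma^{\mathfrak A}:(X,d_X)\longmapsto(C(X,\mathfrak A),\mathsf L_X)$$ is well defined from isometry classes of compact metric spaces to quantum isometry classes of quasi-Leibniz compact quantum metric spaces, and it is continuous when the former are topologized by $\mathrm{GH}$ and the latter carry the quotient topology induced by $\Lambda$. In particular, for all compact metric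 spaces $X,Y$, $$\Lambda\big((C(X,\mathfrak A),\mathsf L_X),(C(Y,\mathfrak A),\mathsf L_Y)\big)\le\sqrt2\cdot m_{\mathfrak A}\cdot\mathrm{GH}(X,Y).$$ -/

import Mathlib

open scoped ENNReal Topology ComplexOrder Matrix.Norms.L2Operator

universe u

namespace QPropinquity

/-! ### States and the Monge-Kantorovich metric -/

/-- The states of a unital C*-algebra: the positive unital continuous linear functionals.
As a subset of `WeakDual ℂ A` it carries the weak* topology. -/
def stateSpace (A : Type u) [CStarAlgebra A] : Set (WeakDual ℂ A) :=
  {φ | φ 1 = 1 ∧ ∀ a : A, 0 ≤ φ (star a * a)}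

/-- The Monge-Kantorovich (extended) distance of a `[0, ∞]`-valued seminorm `L` on the
self-adjoint elements. -/
noncomputable def mkDist {A : Type u} [CStarAlgebra A] (L : selfAdjoint A → ℝ≥0∞)
    (φ ψ : WeakDual ℂ A) : ℝ≥0∞ :=
  ⨆ (a : selfAdjoint A) (_ : L a ≤ 1), ‖φ (a : A) - ψ (a : A)‖ₑ

/-- The Jordan product `(ab + ba) / 2` of self-adjoint elements. -/
noncomputable def jordanMul {A : Type u} [CStarAlgebra A] (a b : selfAdjoint A) :
    selfAdjoint A :=
  ⟨(1 / 2 : ℂ) • ((a : A) * b + b * a), by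
    have ha : star (a : A) = a := a.2
    have hb : star (b : A) = b := b.2
    rw [selfAdjoint.mem_iff, star_smul, star_add, star_mul, star_mul, ha, hb,
      add_comm ((b : A) * a)]
    simp⟩

/-- The Lie product `(ab - ba) / (2i)` of self-adjoint elements. -/
noncomputable def lieMul {A : Type u} [CStarAlgebra A] (a b : selfAdjoint A) :
    selfAdjoint A :=
  ⟨(1 / (2 * Complex.I) : ℂ) • ((a : A) * b - b * a), by
    have ha : star (a : A) = a := a.2
    have hb : star (b : A) = b := b.2
    have hc : star (1 / (2 * Complex.I) : ℂ) = -(1 / (2 * Complex.I)) := by simp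
    rw [selfAdjoint.mem_iff, star_smul, star_sub, star_mul, star_mul, ha, hb, hc, neg_smul,
      ← smul_neg, neg_sub]⟩

/-! ### Quasi-Leibniz compact quantum metric spaces -/

/-- `(A, L)` is a compact quantum metric space: `A` is a nonzero unital C*-algebra, and `L` is a
lower semicontinuous seminorm over `ℝ` on the self-adjoint elements, allowed to take the value `∞`,
finite on a dense subspace, vanishing exactly on `ℝ1`, whose Monge-Kantorovich metric induces the
weak* topology of the state space. -/
structure IsCompactQuantumMetric (A : Type u) [CStarAlgebra A] (L : selfAdjoint A → ℝ≥0∞) :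
    Prop where
  nontrivial : Nontrivial A
  add_le : ∀ a b : selfAdjoint A, L (a + b) ≤ L a + L b
  smul : ∀ (r : ℝ) (a : selfAdjoint A), L (r • a) = ‖r‖ₑ * L a
  dense_dom : Dense {a : selfAdjoint A | L a < ∞}
  eq_zero_iff : ∀ a : selfAdjoint A, L a = 0 ↔ ∃ r : ℝ, a = r • (1 : selfAdjoint A)
  metrizes : ∀ φ : stateSpace A,
    (𝓝 φ).HasBasis (fun ε : ℝ≥0∞ => 0 < ε) (fun ε => {ψ : stateSpace A | mkDist L φ ψ < ε})
  lsc : LowerSemicontinuous L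

/-- `(A, L)` is a `(C, D)`-quasi-Leibniz compact quantum metric space. -/
structure IsQuasiLeibnizCQMS (A : Type u) [CStarAlgebra A] (C D : ℝ)
    (L : selfAdjoint A → ℝ≥0∞) : Prop where
  isCompactQuantumMetric : IsCompactQuantumMetric A L
  one_le : 1 ≤ C
  nonneg : 0 ≤ D
  quasiLeibniz : ∀ a b : selfAdjoint A, L a < ∞ → L b < ∞ →
    max (L (jordanMul a b)) (L (lieMul a b)) ≤
      ENNReal.ofReal C * (‖(a : A)‖ₑ * L b + ‖(b : A)‖ₑ * L a) + ENNReal.ofReal D * L a * L b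

/-- The class `qLCQMS` of all quasi-Leibniz compact quantum metric spaces. -/
structure QLCQMS : Type (u + 1) where
  carrier : Type u
  [cstar : CStarAlgebra carrier]
  L : selfAdjoint carrier → ℝ≥0∞
  isQL : ∃ C D : ℝ, IsQuasiLeibnizCQMS carrier C D L

attribute [instance] QLCQMS.cstar

/-! ### Bridges, treks and the quantum Gromov-Hausdorff propinquity -/

/-- The 1-level set of `ω`: the states `φ` with `φ((1 - ω)*(1 - ω)) = φ((1 - ω)(1 - ω)*) = 0`. -/
def levelSet {D : Type u} [CStarAlgebra D] (ω : D) : Set (WeakDual ℂ D) :=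
  {φ | φ ∈ stateSpace D ∧ φ (star (1 - ω) * (1 - ω)) = 0 ∧ φ ((1 - ω) * star (1 - ω)) = 0}

/-- A bridge from `A` to `B`: a unital C*-algebra `D`, a pivot `ω ∈ D` with nonempty 1-level set,
and unital *-monomorphisms from `A` and `B` to `D`. -/
structure Bridge (A B : Type u) [CStarAlgebra A] [CStarAlgebra B] : Type (u + 1) where
  D : Type u
  [cstar : CStarAlgebra D]
  pivot : D
  left : A →⋆ₐ[ℂ] D
  right : B →⋆ₐ[ℂ] D
  left_injective : Function.Injective left
  right_injective : Function.Injective right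
  levelSet_nonempty : (levelSet pivot).Nonempty

attribute [instance] Bridge.cstar

/-- The Hausdorff distance between two sets for a `[0, ∞]`-valued distance function `d`. -/
noncomputable def hausdorffOf {α : Type u} (d : α → α → ℝ≥0∞) (s t : Set α) : ℝ≥0∞ :=
  max (⨆ x ∈ s, ⨅ y ∈ t, d x y) (⨆ y ∈ t, ⨅ x ∈ s, d x y)

/-- The reach of a bridge: the Hausdorff distance in `D` between `{a ω : L_A(a) ≤ 1}` and
`{ω b : L_B(b) ≤ 1}`. -/
noncomputable def Bridge.reach {A B : Type u} [CStarAlgebra A] [CStarAlgebra B] (γ : Bridge A B)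
    (LA : selfAdjoint A → ℝ≥0∞) (LB : selfAdjoint B → ℝ≥0∞) : ℝ≥0∞ :=
  hausdorffOf (fun x y : γ.D => edist x y)
    {x | ∃ a : selfAdjoint A, LA a ≤ 1 ∧ x = γ.left a * γ.pivot}
    {y | ∃ b : selfAdjoint B, LB b ≤ 1 ∧ y = γ.pivot * γ.right b}

/-- The height of a bridge: the larger of the Hausdorff distances, for the Monge-Kantorovich
metrics, between the state spaces of `A` and `B` and the sets of states obtained by composing the
states of the 1-level set of the pivot with the two *-monomorphisms. -/
noncomputable def Bridge.height {A B : Type u} [CStarAlgebra A] [CStarAlgebra B] (γ : Bridge A B)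
    (LA : selfAdjoint A → ℝ≥0∞) (LB : selfAdjoint B → ℝ≥0∞) : ℝ≥0∞ :=
  max
    (hausdorffOf (mkDist LA) (stateSpace A)
      {ψ | ∃ φ ∈ levelSet γ.pivot, ∀ a : A, ψ a = φ (γ.left a)})
    (hausdorffOf (mkDist LB) (stateSpace B)
      {ψ | ∃ φ ∈ levelSet γ.pivot, ∀ b : B, ψ b = φ (γ.right b)})

/-- The length of a bridge. -/
noncomputable def Bridge.length {A B : Type u} [CStarAlgebra A] [CStarAlgebra B] (γ : Bridge A B)
    (LA : selfAdjoint A → ℝ≥0∞) (LB : selfAdjoint B → ℝ≥0∞) : ℝ≥0∞ :=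
  max (γ.reach LA LB) (γ.height LA LB)

/-- A trek: a finite nonempty chain of bridges through quasi-Leibniz compact quantum metric
spaces. -/
inductive Trek : QLCQMS.{u} → QLCQMS.{u} → Type (u + 1)
  | single {P Q : QLCQMS.{u}} (γ : Bridge P.carrier Q.carrier) : Trek P Q
  | cons {P Q R : QLCQMS.{u}} (γ : Bridge P.carrier Q.carrier) (τ : Trek Q R) : Trek P R

/-- The length of a trek: the sum of the lengths of its bridges. -/
noncomputable def Trek.length : {P Q : QLCQMS.{u}} → Trek P Q → ℝ≥0∞
  | P, Q, .single γ => γ.length P.L Q.L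
  | P, _, .cons (Q := Q) γ τ => γ.length P.L Q.L + τ.length

/-- The quantum Gromov-Hausdorff propinquity: the infimum of the lengths of treks. -/
noncomputable def propinquity (P Q : QLCQMS.{u}) : ℝ≥0∞ :=
  ⨅ τ : Trek P Q, τ.length

/-! ### Quantum isometry classes and their topology -/

/-- Quantum isometry: a *-isomorphism `π` with `L_B ∘ π = L_A`. -/
def QuantumIsometric (P Q : QLCQMS.{u}) : Prop :=
  ∃ π : P.carrier ≃⋆ₐ[ℂ] Q.carrier, ∀ a : selfAdjoint P.carrier,
    Q.L ⟨π a, IsSelfAdjoint.map a.2 π⟩ = P.L a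

theorem quantumIsometric_equivalence : Equivalence QuantumIsometric.{u} where
  refl _ := ⟨StarAlgEquiv.refl _ _, fun _ => rfl⟩
  symm := by
    rintro P Q ⟨π, h⟩
    refine ⟨π.symm, fun b => ?_⟩
    rw [← h]
    congr 1
    exact Subtype.ext (π.apply_symm_apply (b : Q.carrier))
  trans := by
    rintro P Q R ⟨π, h⟩ ⟨ρ, k⟩
    exact ⟨π.trans ρ, fun a => (k ⟨π a, IsSelfAdjoint.map a.2 π⟩).trans (h a)⟩

instance quantumIsometrySetoid : Setoid QLCQMS.{u} :=
  ⟨QuantumIsometric, quantumIsometric_equivalence⟩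

/-- The topology of the propinquity: a set is open if with each point it contains a ball. -/
instance propinquityTopology : TopologicalSpace QLCQMS.{u} where
  IsOpen U := ∀ P ∈ U, ∃ ε : ℝ≥0∞, 0 < ε ∧ ∀ Q, propinquity P Q < ε → Q ∈ U
  isOpen_univ := fun _ _ => ⟨1, one_pos, fun _ _ => trivial⟩
  isOpen_inter := by
    rintro U V hU hV P ⟨hPU, hPV⟩
    obtain ⟨ε, hε, h⟩ := hU P hPU
    obtain ⟨δ, hδ, k⟩ := hV P hPV
    exact ⟨min ε δ, lt_min hε hδ, fun Q hQ =>
      ⟨h Q (hQ.trans_le (min_le_left _ _)), k Q (hQ.trans_le (min_le_right _ _))⟩⟩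
  isOpen_sUnion := by
    rintro S hS P ⟨U, hU, hP⟩
    obtain ⟨ε, hε, h⟩ := hS U hU P hP
    exact ⟨ε, hε, fun Q hQ => ⟨U, hU, h Q hQ⟩⟩

/-- The space of quantum isometry classes, with the quotient topology. -/
abbrev QLCQMSClass : Type (u + 1) := Quotient quantumIsometrySetoid.{u}

/-! ### The algebras `C(X, 𝔄)` and their Lip-norms -/

/-- The finite-dimensional C*-algebra `⊕ M_{m l}(ℂ)`, `l = 0, …, n`, where each matrix algebra has
the operator norm for the Euclidean norm on `ℂ ^ (m l)`. -/
abbrev FDAlg {n : ℕ} (m : Fin (n + 1) → ℕ) : Type :=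
  ∀ l : Fin (n + 1), Matrix (Fin (m l)) (Fin (m l)) ℂ

/-- The largest block size. -/
def maxSize {n : ℕ} (m : Fin (n + 1) → ℕ) : ℕ := Finset.univ.sup m

/-- The largest absolute value of the real and imaginary parts of the matrix entries of `a`. -/
noncomputable def realMaxNorm {n : ℕ} {m : Fin (n + 1) → ℕ} (a : FDAlg m) : ℝ≥0∞ :=
  ⨆ (l : Fin (n + 1)) (j : Fin (m l)) (k : Fin (m l)),
    ENNReal.ofReal (max |(a l j k).re| |(a l j k).im|)

/-- The seminorm
`max {sup_{x ≠ y} ‖a(x) - a(y)‖ / d(x, y), inf_{r ∈ ℝ} sup_x ‖a(x) - r1‖}`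
on the self-adjoint elements of `C(X, 𝔄)`, where `‖·‖` is `realMaxNorm`. -/
noncomputable def lipNorm {n : ℕ} (m : Fin (n + 1) → ℕ) (X : Type u) [MetricSpace X]
    [CompactSpace X] (a : selfAdjoint C(X, FDAlg m)) : ℝ≥0∞ :=
  max
    (⨆ (x : X) (y : X) (_ : x ≠ y),
      realMaxNorm ((a : C(X, FDAlg m)) x - (a : C(X, FDAlg m)) y) / edist x y)
    (⨅ r : ℝ, ⨆ x : X, realMaxNorm ((a : C(X, FDAlg m)) x - r • (1 : FDAlg m)))

/-- The quasi-Leibniz compact quantum metric space formed by a C*-algebra and a quasi-Leibniz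
Lip-norm. -/
def QLCQMS.of {A : Type u} [CStarAlgebra A] {C D : ℝ} {L : selfAdjoint A → ℝ≥0∞}
    (h : IsQuasiLeibnizCQMS A C D L) : QLCQMS.{u} :=
  ⟨A, L, C, D, h⟩

end QPropinquity

namespace QPropinquity

/-! ### States of unital C*-algebras -/

section States

variable {A : Type u} [CStarAlgebra A]

/-! Everything rests on comparing the entrywise norm with the C*-norm of `𝔄`: `realMaxNorm_le_enorm`
has constant `1`, and `enorm_le_realMaxNorm` has constant `√2 * maxSize m`, the source of both
constants in the theorem.

The quasi-Leibniz inequality telescopes `ab - a'b' = a(b - b') + (a - a')b'` in the C*-norm and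
converts differences from the entrywise norm, paying the constant once
(`max_lipConst_scalarDist_le_of_product`). For the scalar part, `a'` and `b'` are best real
multiples of `1`, chosen no larger than `‖a‖` and `‖b‖`. By Arzelà–Ascoli, `{L ≤ 1}` is totally
bounded modulo `ℝ1`, which is Rieffel's criterion for the Monge-Kantorovich metric to induce the
weak* topology (`hasBasis_nhds_mkDist`). Stone–Weierstrass makes the domain dense.

For the estimate, put `X` and `Y` in a common space at Hausdorff distance `δ = GH(X, Y)`. The pairs
`(x, y)` at distance at most `δ` form a compact space `W` projecting onto `X` and `Y`, so both
algebras embed in `C(W, 𝔄)`. With pivot `1` the height vanishes, since states extend by Hahn–Banach.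
For the reach, the real and imaginary parts of the entries of `a` are extended by McShane, truncated
to their range, and the result is made self-adjoint. This yields `b` in the unit ball of `L_Y`, with
`a(x)` and `b(y)` entrywise within `d(x, y)` (`exists_lipNorm_le_one_norm_sub_le`), hence within `√2
* maxSize m * δ` on `W`. Continuity follows from this Lipschitz bound. -/

theorem exists_star_mul_self_eq_norm_sub {a : A} (ha : IsSelfAdjoint a) :
    ∃ c : A, star c * c = algebraMap ℝ A ‖a‖ - a := by
  let := CStarAlgebra.spectralOrder A
  let := CStarAlgebra.spectralOrderedRing A
  have h : 0 ≤ algebraMap ℝ A ‖a‖ - a := sub_nonneg.2 ha.le_algebraMap_norm_self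
  obtain ⟨c, hc⟩ := CStarAlgebra.nonneg_iff_eq_star_mul_self.1 h
  exact ⟨c, hc.symm⟩

/-- Holds because `0 ≤ ‖b‖1 - b ≤ ‖b‖1` for `b = star a * a`. It is what turns contractivity of a
unital functional into positivity. -/
theorem norm_norm_sub_star_mul_self_le (a : A) :
    ‖algebraMap ℝ A ‖star a * a‖ - star a * a‖ ≤ ‖star a * a‖ := by
  let := CStarAlgebra.spectralOrder A
  let := CStarAlgebra.spectralOrderedRing A
  have h0 : 0 ≤ star a * a := star_mul_self_nonneg a
  have h1 : 0 ≤ algebraMap ℝ A ‖star a * a‖ - star a * a :=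
    sub_nonneg.2 (IsSelfAdjoint.of_nonneg h0).le_algebraMap_norm_self
  refine (CStarAlgebra.norm_le_norm_of_nonneg_of_le h1 (sub_le_self _ h0)).trans ?_
  rcases subsingleton_or_nontrivial A with h | h
  · simp [Subsingleton.elim _ (0 : A)]
  · rw [norm_algebraMap']; simp

theorem apply_algebraMap_real {φ : WeakDual ℂ A} (h : φ 1 = 1) (r : ℝ) :
    φ (algebraMap ℝ A r) = r := by
  have : algebraMap ℝ A r = (r : ℂ) • (1 : A) := by
    rw [Algebra.algebraMap_eq_smul_one]; simp
  rw [this, map_smul, h]; simp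

/-- The order is that of `ℂ`, so the inequality also says that `φ a` is real. -/
theorem stateSpace.le_norm_of_isSelfAdjoint {φ : WeakDual ℂ A} (hφ : φ ∈ stateSpace A) {a : A}
    (ha : IsSelfAdjoint a) : φ a ≤ ‖a‖ := by
  obtain ⟨c, hc⟩ := exists_star_mul_self_eq_norm_sub ha
  have := hφ.2 c
  rw [hc, map_sub, apply_algebraMap_real hφ.1] at this
  exact sub_nonneg.1 this

theorem stateSpace.im_eq_zero {φ : WeakDual ℂ A} (hφ : φ ∈ stateSpace A) {a : A}
    (ha : IsSelfAdjoint a) : (φ a).im = 0 := by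
  have := (Complex.le_def.1 (stateSpace.le_norm_of_isSelfAdjoint hφ ha)).2
  simpa using this

theorem stateSpace.norm_apply_le {φ : WeakDual ℂ A} (hφ : φ ∈ stateSpace A) (a : A) :
    ‖φ a‖ ≤ ‖a‖ := by
  -- Rotating `a` by a phase makes `φ a` real and nonnegative; then only the self-adjoint part of `c
  -- • a` contributes.
  obtain ⟨c, hc1, hc⟩ : ∃ c : ℂ, ‖c‖ = 1 ∧ (‖φ a‖ : ℂ) = c * φ a := by
    by_cases h : φ a = 0
    · exact ⟨1, by simp, by simp [h]⟩
    · refine ⟨(‖φ a‖ : ℂ) / φ a, ?_, ?_⟩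
      · simp [h]
      · field_simp
  have key : (φ (c • a)).re ≤ ‖c • a‖ := by
    have h1 := realPart_add_I_smul_imaginaryPart (c • a)
    have h2 : (φ (c • a)).re = (φ (realPart (c • a) : A)).re := by
      conv_lhs => rw [← h1]
      rw [map_add, map_smul φ]
      simp [stateSpace.im_eq_zero hφ (imaginaryPart (c • a)).2]
    rw [h2]
    have h3 := (Complex.le_def.1 (stateSpace.le_norm_of_isSelfAdjoint hφ (realPart (c • a)).2)).1
    refine (by simpa using h3 : _ ≤ _).trans (realPart.norm_le _)
  rw [map_smul, smul_eq_mul, ← hc, norm_smul, hc1] at key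
  simpa using key

theorem mem_stateSpace_of_norm_apply_le {φ : WeakDual ℂ A} (h1 : φ 1 = 1)
    (h : ∀ a, ‖φ a‖ ≤ ‖a‖) : φ ∈ stateSpace A := by
  have him : ∀ a : A, IsSelfAdjoint a → (φ a).im = 0 := by
    intro a ha
    -- Contractivity at `a + it1` gives `|φ a + it|² ≤ ‖a‖² + t²`. The `t²` cancels, and a linear
    -- function of `t` bounded above must have slope zero.
    have key : ∀ t : ℝ, 2 * (φ a).im * t ≤ ‖a‖ ^ 2 := by
      intro t
      set b : A := a + (t * Complex.I : ℂ) • (1 : A) with hb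
      have hbb : star b * b = a * a + ((t : ℂ) ^ 2) • (1 : A) := by
        simp only [hb, star_add, star_smul, ha.star_eq, star_one, add_mul, mul_add, smul_mul_assoc,
          one_mul, mul_smul_comm, mul_one]
        have : star ((t : ℂ) * Complex.I) = - (t * Complex.I) := by simp
        rw [this]
        have h2 : (t * Complex.I) * -(t * Complex.I) = (t : ℂ) ^ 2 := by
          have := Complex.I_sq
          linear_combination (-(t : ℂ) ^ 2) * this
        rw [neg_smul, smul_add, smul_smul]
        rw [← h2]
        module
      have hn : ‖b‖ ^ 2 ≤ ‖a‖ ^ 2 + t ^ 2 := by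
        rw [sq, ← CStarRing.norm_star_mul_self, hbb]
        refine (norm_add_le _ _).trans (add_le_add ?_ ?_)
        · rw [sq]; exact norm_mul_le _ _
        · rw [norm_smul]
          have : ‖(1 : A)‖ ≤ 1 := by
            rcases subsingleton_or_nontrivial A with hA | hA
            · simp [Subsingleton.elim (1 : A) 0]
            · simp
          calc _ ≤ ‖((t : ℂ) ^ 2)‖ * 1 := by gcongr
            _ = t ^ 2 := by simp
      have h3 : ‖φ b‖ ^ 2 ≤ ‖b‖ ^ 2 := by gcongr; exact h b
      have h4 : φ b = φ a + t * Complex.I := by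
        rw [hb, map_add, map_smul, h1]; simp
      rw [h4, ← Complex.normSq_eq_norm_sq, Complex.normSq_apply] at h3
      simp at h3
      nlinarith [sq_nonneg (φ a).re, sq_nonneg (φ a).im]
    by_contra hne
    have := key ((‖a‖ ^ 2 + 1) / (2 * (φ a).im))
    rw [mul_div_cancel₀ _ (by simpa using hne)] at this
    linarith
  refine ⟨h1, fun a => ?_⟩
  have h2 := him _ (IsSelfAdjoint.star_mul_self a)
  have h3 := (h _).trans (norm_norm_sub_star_mul_self_le a)
  rw [map_sub, apply_algebraMap_real h1] at h3
  have h4 := (Complex.abs_re_le_norm _).trans h3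
  rw [Complex.le_def]
  refine ⟨?_, by simpa using h2.symm⟩
  have := (abs_le.1 h4).2
  simp at this
  simpa using this

theorem stateSpace_nonempty [Nontrivial A] : (stateSpace A).Nonempty := by
  obtain ⟨g, hg, hg1⟩ := exists_dual_vector ℂ (1 : A) (by simp)
  refine ⟨StrongDual.toWeakDual g, mem_stateSpace_of_norm_apply_le ?_ fun a => ?_⟩
  · simpa using hg1
  · simpa [hg] using g.le_opNorm a

theorem stateSpace.comp_mem {B : Type u} [CStarAlgebra B] (ρ : A →⋆ₐ[ℂ] B) {φ : WeakDual ℂ B}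
    (hφ : φ ∈ stateSpace B) {ψ : WeakDual ℂ A} (h : ∀ a, ψ a = φ (ρ a)) : ψ ∈ stateSpace A := by
  refine ⟨by rw [h, map_one, hφ.1], fun a => ?_⟩
  rw [h, map_mul, map_star]
  exact hφ.2 _

/-- An injective *-homomorphism is isometric, so `ψ` is contractive on the range of `ρ`. A
norm-preserving Hahn–Banach extension is unital and contractive, hence a state. -/
theorem stateSpace.exists_extension {B : Type u} [CStarAlgebra B] (ρ : A →⋆ₐ[ℂ] B)
    (hρ : Function.Injective ρ) {ψ : WeakDual ℂ A} (hψ : ψ ∈ stateSpace A) :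
    ∃ φ ∈ stateSpace B, ∀ a, ψ a = φ (ρ a) := by
  have hn : ∀ a, ‖ρ a‖ = ‖a‖ := NonUnitalStarAlgHom.norm_map ρ hρ
  let e := LinearEquiv.ofInjective (ρ.toAlgHom.toLinearMap) hρ
  let f : StrongDual ℂ (LinearMap.range ρ.toAlgHom.toLinearMap) :=
    LinearMap.mkContinuous ((WeakDual.toStrongDual ψ).toLinearMap ∘ₗ e.symm.toLinearMap) 1 (by
      rintro ⟨_, a, rfl⟩
      have : e.symm ⟨ρ.toAlgHom.toLinearMap a, a, rfl⟩ = a := by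
        rw [LinearEquiv.symm_apply_eq]; rfl
      simp only [LinearMap.comp_apply, LinearEquiv.coe_coe, this, one_mul]
      refine (stateSpace.norm_apply_le hψ a).trans ?_
      rw [← hn a]; rfl)
  obtain ⟨g, hg, hgn⟩ := exists_extension_norm_eq _ f
  have hga : ∀ a, g (ρ a) = ψ a := by
    intro a
    have := hg ⟨ρ.toAlgHom.toLinearMap a, a, rfl⟩
    refine this.trans ?_
    have : e.symm ⟨ρ.toAlgHom.toLinearMap a, a, rfl⟩ = a := by
      rw [LinearEquiv.symm_apply_eq]; rfl
    show ψ (e.symm _) = ψ a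
    rw [this]
  refine ⟨StrongDual.toWeakDual g, mem_stateSpace_of_norm_apply_le ?_ fun a => ?_,
    fun a => (hga a).symm⟩
  · have := hga 1
    rw [map_one, hψ.1] at this
    exact this
  · have : ‖g‖ ≤ 1 := hgn ▸ LinearMap.mkContinuous_norm_le _ zero_le_one _
    exact (g.le_opNorm a).trans (mul_le_of_le_one_left (norm_nonneg _) this)

end States
/-! ### A criterion for the Monge-Kantorovich metric to metrize the weak* topology -/

section Metrizes

variable {A : Type u} [CStarAlgebra A] {L : selfAdjoint A → ℝ≥0∞}

theorem enorm_apply_sub_le_mkDist {a : selfAdjoint A} (ha : L a ≤ 1) (φ ψ : WeakDual ℂ A) :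
    ‖φ (a : A) - ψ (a : A)‖ₑ ≤ mkDist L φ ψ :=
  le_iSup₂_of_le a ha le_rfl

theorem mkDist_self (φ : WeakDual ℂ A) : mkDist L φ φ = 0 := by
  simp [mkDist]

/-- For each self-adjoint `a`, the evaluation at `a` is continuous for the Monge-Kantorovich
metric on the state space. -/
theorem exists_mkDist_lt_imp_norm_sub_lt
    (smul : ∀ (r : ℝ) (a : selfAdjoint A), L (r • a) = ‖r‖ₑ * L a)
    (dense_dom : Dense {a : selfAdjoint A | L a < ∞}) {φ : WeakDual ℂ A}
    (hφ : φ ∈ stateSpace A) (a : selfAdjoint A) {ε : ℝ} (hε : 0 < ε) :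
    ∃ δ : ℝ≥0∞, 0 < δ ∧ ∀ ψ ∈ stateSpace A, mkDist L φ ψ < δ →
      ‖φ (a : A) - ψ (a : A)‖ < ε := by
  obtain ⟨b, hb, hab⟩ := Metric.dense_iff.1 dense_dom a (ε / 3) (by positivity)
  -- The maximum with `1` keeps the scaling factor positive when `L b = 0`.
  set c : ℝ := max 1 (L b).toReal
  have hc : 0 < c := lt_of_lt_of_le one_pos (le_max_left _ _)
  have hLb : L (c⁻¹ • b) ≤ 1 := by
    rw [smul]
    have h1 : L b ≤ ENNReal.ofReal c := by
      rw [← ENNReal.ofReal_toReal (ne_of_lt hab)]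
      exact ENNReal.ofReal_le_ofReal (le_max_right _ _)
    calc ‖c⁻¹‖ₑ * L b ≤ ‖c⁻¹‖ₑ * ENNReal.ofReal c := by gcongr
      _ = 1 := by
        rw [Real.enorm_eq_ofReal (by positivity), ← ENNReal.ofReal_mul (by positivity),
          inv_mul_cancel₀ hc.ne', ENNReal.ofReal_one]
  refine ⟨ENNReal.ofReal (ε / (3 * c)), by simp; positivity, fun ψ hψ h => ?_⟩
  have h2 := (enorm_apply_sub_le_mkDist hLb φ ψ).trans_lt h
  rw [← ofReal_norm, ENNReal.ofReal_lt_ofReal_iff (by positivity)] at h2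
  have hs : ((c⁻¹ • b : selfAdjoint A) : A) = ((c⁻¹ : ℝ) : ℂ) • (b : A) :=
    (Complex.coe_smul _ _).symm
  rw [hs, map_smul φ, map_smul ψ, ← smul_sub, norm_smul, Complex.norm_real, Real.norm_eq_abs,
    abs_of_pos (by positivity), lt_div_iff₀ (by positivity)] at h2
  have h3 : ‖φ (b : A) - ψ (b : A)‖ < ε / 3 := by
    have : c⁻¹ * ‖φ (b : A) - ψ (b : A)‖ * (3 * c) = 3 * ‖φ (b : A) - ψ (b : A)‖ := by
      field_simp
    linarith
  have h4 : ‖(a : A) - b‖ < ε / 3 := by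
    rw [Metric.mem_ball, dist_comm, dist_eq_norm] at hb
    exact hb
  have h5 := stateSpace.norm_apply_le hφ ((a : A) - b)
  have h6 := stateSpace.norm_apply_le hψ ((a : A) - b)
  calc ‖φ (a : A) - ψ (a : A)‖
      = ‖φ ((a : A) - b) + (φ (b : A) - ψ (b : A)) - ψ ((a : A) - b)‖ := by
        rw [map_sub, map_sub]; congr 1; ring
    _ ≤ ‖φ ((a : A) - b)‖ + ‖φ (b : A) - ψ (b : A)‖ + ‖ψ ((a : A) - b)‖ :=
        (norm_sub_le _ _).trans (add_le_add (norm_add_le _ _) le_rfl)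
    _ < ε := by linarith

/-- If `L` is finite on a dense subspace and the set `{L ≤ 1}` is totally bounded modulo `ℝ1`,
then the Monge-Kantorovich metric of `L` metrizes the weak* topology of the state space. -/
theorem hasBasis_nhds_mkDist
    (smul : ∀ (r : ℝ) (a : selfAdjoint A), L (r • a) = ‖r‖ₑ * L a)
    (dense_dom : Dense {a : selfAdjoint A | L a < ∞})
    (net : ∀ ε : ℝ, 0 < ε → ∃ F : Set A, F.Finite ∧ ∀ a : selfAdjoint A, L a ≤ 1 →
      ∃ b ∈ F, ∃ r : ℝ, ‖(a : A) - (r : ℂ) • (1 : A) - b‖ ≤ ε) (φ : stateSpace A) :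
    (𝓝 φ).HasBasis (fun ε : ℝ≥0∞ => 0 < ε) (fun ε => {ψ : stateSpace A | mkDist L φ ψ < ε}) := by
  have hcont : ∀ b : A, Continuous fun ψ : stateSpace A => (ψ : WeakDual ℂ A) b := fun b =>
    (WeakDual.eval_continuous b).comp continuous_subtype_val
  have hball : ∀ ε : ℝ≥0∞, 0 < ε → {ψ : stateSpace A | mkDist L φ ψ < ε} ∈ 𝓝 φ := by
    intro ε hε
    obtain ⟨η, hη, hηε⟩ := ENNReal.lt_iff_exists_nnreal_btwn.1 hε
    have hη' : 0 < (η : ℝ) := by exact_mod_cast hη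
    obtain ⟨F, hF, hnet⟩ := net (η / 3) (by positivity)
    -- Only finitely many evaluations matter: `r1` drops out because both states are unital, and the
    -- remainder `c` costs at most `η / 3` in each state.
    have : ∀ᶠ ψ in 𝓝 φ, ∀ b ∈ F, ‖φ.1 b - ψ.1 b‖ < η / 3 := by
      rw [Filter.eventually_all_finite hF]
      intro b _
      have : Continuous fun ψ : stateSpace A => ‖φ.1 b - ψ.1 b‖ :=
        (continuous_const.sub (hcont b)).norm
      exact this.continuousAt.eventually_lt continuousAt_const (by simpa using hη')
    filter_upwards [this] with ψ hψ
    refine lt_of_le_of_lt ?_ hηε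
    refine iSup₂_le fun a ha => ?_
    obtain ⟨b, hb, r, hr⟩ := hnet a ha
    rw [← ofReal_norm, ← ENNReal.ofReal_coe_nnreal]
    refine ENNReal.ofReal_le_ofReal ?_
    set c : A := (a : A) - (r : ℂ) • (1 : A) - b with hc
    have hac : (a : A) = c + (r : ℂ) • (1 : A) + b := by rw [hc]; abel
    have h1 := (stateSpace.norm_apply_le φ.2 c).trans hr
    have h2 := (stateSpace.norm_apply_le ψ.2 c).trans hr
    calc ‖φ.1 (a : A) - ψ.1 (a : A)‖
        = ‖φ.1 c + (φ.1 b - ψ.1 b) - ψ.1 c‖ := by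
          rw [hac, map_add φ.1, map_add φ.1, map_add ψ.1, map_add ψ.1, map_smul φ.1, map_smul ψ.1,
            φ.2.1, ψ.2.1]
          congr 1; ring
      _ ≤ ‖φ.1 c‖ + ‖φ.1 b - ψ.1 b‖ + ‖ψ.1 c‖ :=
          (norm_sub_le _ _).trans (add_le_add (norm_add_le _ _) le_rfl)
      _ ≤ η := by linarith [hψ b hb]
  refine Filter.hasBasis_iff.2 fun U => ⟨fun hU => ?_, fun ⟨ε, hε, h⟩ =>
    Filter.mem_of_superset (hball ε hε) h⟩
  -- Conversely, the filter generated by the balls converges weak* to `φ`: evaluations converge at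
  -- self-adjoint elements, hence everywhere by splitting into real and imaginary parts.
  have hle : (⨅ (ε : ℝ≥0∞) (_ : 0 < ε), Filter.principal {ψ : stateSpace A | mkDist L φ ψ < ε})
      ≤ 𝓝 φ := by
    set F := ⨅ (ε : ℝ≥0∞) (_ : 0 < ε), Filter.principal {ψ : stateSpace A | mkDist L φ ψ < ε}
    have hmem : ∀ ε : ℝ≥0∞, 0 < ε → {ψ : stateSpace A | mkDist L φ ψ < ε} ∈ F := fun ε hε =>
      Filter.mem_iInf_of_mem ε (Filter.mem_iInf_of_mem hε (Filter.mem_principal_self _))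
    have hsa : ∀ a : selfAdjoint A, Filter.Tendsto (fun ψ : stateSpace A => ψ.1 (a : A)) F
        (𝓝 (φ.1 (a : A))) := by
      intro a
      rw [Metric.tendsto_nhds]
      intro ε hε
      obtain ⟨δ, hδ, h⟩ := exists_mkDist_lt_imp_norm_sub_lt smul dense_dom φ.2 a hε
      filter_upwards [hmem δ hδ] with ψ hψ
      rw [dist_comm, dist_eq_norm]
      exact h ψ.1 ψ.2 hψ
    have : Filter.Tendsto (fun ψ : stateSpace A => ψ) F (𝓝 φ) := by
      rw [tendsto_subtype_rng, tendsto_iff_forall_eval_tendsto_topDualPairing]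
      intro a
      have hdec : ∀ ψ : stateSpace A, ψ.1 a =
          ψ.1 (realPart a : A) + Complex.I * ψ.1 (imaginaryPart a : A) := by
        intro ψ
        conv_lhs => rw [← realPart_add_I_smul_imaginaryPart a]
        rw [map_add ψ.1, map_smul ψ.1, smul_eq_mul]
      change Filter.Tendsto (fun ψ : stateSpace A => ψ.1 a) F (𝓝 (φ.1 a))
      rw [hdec φ]
      exact ((hsa _).add ((hsa _).const_mul _)).congr fun ψ => (hdec ψ).symm
    exact this
  have hU' := hle hU
  have hdir : DirectedOn ((fun ε : ℝ≥0∞ => Filter.principal {ψ : stateSpace A |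
      mkDist L φ ψ < ε}) ⁻¹'o (· ≥ ·)) (Set.Ioi 0) := fun ε hε δ hδ =>
    ⟨min ε δ, Set.mem_Ioi.2 (lt_min (Set.mem_Ioi.1 hε) (Set.mem_Ioi.1 hδ)),
      Filter.principal_mono.2 fun ψ (hψ : mkDist L φ ψ < _) =>
        hψ.trans_le (min_le_left _ _),
      Filter.principal_mono.2 fun ψ (hψ : mkDist L φ ψ < _) =>
        hψ.trans_le (min_le_right _ _)⟩
  obtain ⟨ε, hε, h⟩ := (Filter.mem_biInf_of_directed hdir ⟨1, Set.mem_Ioi.2 one_pos⟩).1 hU'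
  exact ⟨ε, hε, h⟩

end Metrizes

/-! ### The entrywise norm on a finite-dimensional C*-algebra -/

section RealMaxNorm

theorem norm_entry_le_l2_opNorm {k : ℕ} (M : Matrix (Fin k) (Fin k) ℂ) (i j : Fin k) :
    ‖M i j‖ ≤ ‖M‖ := by
  have h := Matrix.l2_opNorm_mulVec M (EuclideanSpace.single j 1)
  rw [PiLp.norm_single, norm_one, mul_one] at h
  refine le_trans ?_ h
  have h2 := PiLp.norm_apply_le (WithLp.toLp 2 (M.mulVec (EuclideanSpace.single j (1 : ℂ)))) i
  simpa using h2

/-- Cauchy–Schwarz bounds each coordinate of `Mx` by `c√k‖x‖`, and summing the squares over `k` rows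
gives the second `√k`. -/
theorem l2_opNorm_le_of_norm_entry_le {k : ℕ} (M : Matrix (Fin k) (Fin k) ℂ) {c : ℝ} (hc : 0 ≤ c)
    (h : ∀ i j, ‖M i j‖ ≤ c) : ‖M‖ ≤ k * c := by
  rw [Matrix.cstar_norm_def]
  refine ContinuousLinearMap.opNorm_le_bound _ (by positivity) fun x => ?_
  rw [EuclideanSpace.norm_eq, Real.sqrt_le_left (by positivity)]
  have hi : ∀ i, ‖(Matrix.toEuclideanCLM (n := Fin k) (𝕜 := ℂ) M x) i‖ ^ 2 ≤
      c ^ 2 * (k * ‖x‖ ^ 2) := by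
    intro i
    have h1 : ‖(Matrix.toEuclideanCLM (n := Fin k) (𝕜 := ℂ) M x) i‖ ≤ c * ∑ j, ‖x j‖ := by
      have : (Matrix.toEuclideanCLM (n := Fin k) (𝕜 := ℂ) M x) i = ∑ j, M i j * x j := by
        rw [Matrix.ofLp_toEuclideanCLM]; rfl
      rw [this, Finset.mul_sum]
      refine norm_sum_le_of_le _ fun j _ => ?_
      rw [norm_mul]
      exact mul_le_mul_of_nonneg_right (h i j) (norm_nonneg _)
    have h2 : (∑ j, ‖x j‖) ^ 2 ≤ k * ‖x‖ ^ 2 := by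
      rw [EuclideanSpace.norm_sq_eq]
      simpa using sq_sum_le_card_mul_sum_sq (s := Finset.univ) (f := fun j => ‖x j‖)
    calc _ ≤ (c * ∑ j, ‖x j‖) ^ 2 := by gcongr
      _ = c ^ 2 * (∑ j, ‖x j‖) ^ 2 := by ring
      _ ≤ _ := by gcongr
  calc _ ≤ ∑ _i : Fin k, c ^ 2 * (k * ‖x‖ ^ 2) := Finset.sum_le_sum fun i _ => hi i
    _ = (k * c * ‖x‖) ^ 2 := by simp; ring

variable {n : ℕ} {m : Fin (n + 1) → ℕ}

theorem realMaxNorm_le_iff {v : FDAlg m} {c : ℝ} (hc : 0 ≤ c) :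
    realMaxNorm v ≤ ENNReal.ofReal c ↔ ∀ l j k, |(v l j k).re| ≤ c ∧ |(v l j k).im| ≤ c := by
  simp only [realMaxNorm, iSup_le_iff, ENNReal.ofReal_le_ofReal_iff hc, max_le_iff]

theorem realMaxNorm_le_enorm (v : FDAlg m) : realMaxNorm v ≤ ‖v‖ₑ := by
  rw [← ofReal_norm, realMaxNorm_le_iff (norm_nonneg _)]
  intro l j k
  have h : ‖v l j k‖ ≤ ‖v‖ := (norm_entry_le_l2_opNorm _ _ _).trans (norm_le_pi_norm v l)
  exact ⟨(Complex.abs_re_le_norm _).trans h, (Complex.abs_im_le_norm _).trans h⟩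

theorem realMaxNorm_lt_top (v : FDAlg m) : realMaxNorm v < ∞ :=
  (realMaxNorm_le_enorm v).trans_lt enorm_lt_top

/-- The `√2` passes from real and imaginary parts to moduli, the block size from entries to the
operator norm. -/
theorem enorm_le_realMaxNorm (v : FDAlg m) :
    ‖v‖ₑ ≤ ENNReal.ofReal (√2 * maxSize m) * realMaxNorm v := by
  have hfin : realMaxNorm v ≠ ∞ := (realMaxNorm_lt_top v).ne
  set c := (realMaxNorm v).toReal with hc
  have hc0 : 0 ≤ c := ENNReal.toReal_nonneg
  have hv : realMaxNorm v = ENNReal.ofReal c := (ENNReal.ofReal_toReal hfin).symm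
  have h := (realMaxNorm_le_iff hc0).1 hv.le
  rw [hv, ← ENNReal.ofReal_mul (by positivity), ← ofReal_norm]
  refine ENNReal.ofReal_le_ofReal ((pi_norm_le_iff_of_nonneg (by positivity)).2 fun l => ?_)
  have hm : (m l : ℝ) ≤ maxSize m := by exact_mod_cast Finset.le_sup (Finset.mem_univ l)
  calc ‖v l‖ ≤ m l * (√2 * c) := by
        refine l2_opNorm_le_of_norm_entry_le _ (by positivity) fun j k => ?_
        refine (Complex.norm_le_sqrt_two_mul_max _).trans ?_
        gcongr
        exact max_le (h l j k).1 (h l j k).2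
    _ ≤ maxSize m * (√2 * c) := by gcongr
    _ = √2 * maxSize m * c := by ring

theorem realMaxNorm_add_le (v w : FDAlg m) :
    realMaxNorm (v + w) ≤ realMaxNorm v + realMaxNorm w := by
  refine iSup_le fun l => iSup₂_le fun j k => ?_
  have h : ∀ u : FDAlg m, ENNReal.ofReal (max |(u l j k).re| |(u l j k).im|) ≤ realMaxNorm u :=
    fun u => le_iSup_of_le l (le_iSup₂_of_le j k le_rfl)
  refine le_trans ?_ (add_le_add (h v) (h w))
  rw [← ENNReal.ofReal_add (by positivity) (by positivity)]
  refine ENNReal.ofReal_le_ofReal (max_le ?_ ?_)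
  · exact (abs_add_le _ _).trans (add_le_add (le_max_left _ _) (le_max_left _ _))
  · exact (abs_add_le _ _).trans (add_le_add (le_max_right _ _) (le_max_right _ _))

theorem realMaxNorm_smul (r : ℝ) (v : FDAlg m) : realMaxNorm (r • v) = ‖r‖ₑ * realMaxNorm v := by
  simp only [realMaxNorm, ENNReal.mul_iSup, Pi.smul_apply, Matrix.smul_apply, Complex.smul_re,
    Complex.smul_im, smul_eq_mul, abs_mul, ← mul_max_of_nonneg _ _ (abs_nonneg r)]
  simp only [ENNReal.ofReal_mul (abs_nonneg r), Real.enorm_eq_ofReal_abs]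

theorem realMaxNorm_star (v : FDAlg m) : realMaxNorm (star v) = realMaxNorm v := by
  refine iSup_congr fun l => ?_
  rw [iSup_comm]
  simp [Matrix.star_apply]

theorem realMaxNorm_zero : realMaxNorm (0 : FDAlg m) = 0 := by
  simp [realMaxNorm]

/-- Taking adjoints only transposes and conjugates entries, so passing to the self-adjoint part is
contractive for the entrywise norm as well. -/
theorem realMaxNorm_half_add_star_le (v : FDAlg m) :
    realMaxNorm ((2⁻¹ : ℝ) • (v + star v)) ≤ realMaxNorm v := by
  rw [realMaxNorm_smul]
  calc _ ≤ ‖(2⁻¹ : ℝ)‖ₑ * (realMaxNorm v + realMaxNorm v) := by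
        gcongr
        exact (realMaxNorm_add_le _ _).trans_eq (by rw [realMaxNorm_star])
    _ = realMaxNorm v := by
        rw [← two_mul, ← mul_assoc, Real.enorm_eq_ofReal (by norm_num),
          ENNReal.ofReal_inv_of_pos (by norm_num)]
        simp [ENNReal.inv_mul_cancel]

end RealMaxNorm

/-! ### Lipschitz functions on compact metric spaces -/

section Lipschitz

/-- Stone–Weierstrass: Lipschitz functions on a compact space form an algebra, and the distance
functions separate points. -/
theorem exists_lipschitzWith_abs_sub_le {X : Type u} [MetricSpace X] [CompactSpace X] (f : C(X, ℝ))
    {ε : ℝ} (hε : 0 < ε) :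
    ∃ g : C(X, ℝ), (∃ K, LipschitzWith K g) ∧ ∀ x, |f x - g x| ≤ ε := by
  let S : Subalgebra ℝ C(X, ℝ) :=
    { carrier := {g | ∃ K, LipschitzWith K g}
      mul_mem' := by
        rintro f g ⟨K, hK⟩ ⟨K', hK'⟩
        refine ⟨‖f‖₊ * K' + ‖g‖₊ * K, LipschitzWith.of_dist_le_mul fun x y => ?_⟩
        have h1 := hK.dist_le_mul x y
        have h2 := hK'.dist_le_mul x y
        rw [Real.dist_eq] at h1 h2 ⊢
        have h3 : |f x| ≤ ‖f‖ := f.norm_coe_le_norm x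
        have h4 : |g y| ≤ ‖g‖ := g.norm_coe_le_norm y
        calc |(f * g) x - (f * g) y| = |f x * (g x - g y) + g y * (f x - f y)| := by
              rw [ContinuousMap.mul_apply, ContinuousMap.mul_apply]; congr 1; ring
          _ ≤ |f x| * |g x - g y| + |g y| * |f x - f y| := by
              rw [← abs_mul, ← abs_mul]; exact abs_add_le _ _
          _ ≤ ‖f‖ * (K' * dist x y) + ‖g‖ * (K * dist x y) := by gcongr
          _ = _ := by push_cast; ring
      add_mem' := by
        rintro f g ⟨K, hK⟩ ⟨K', hK'⟩
        exact ⟨K + K', hK.add hK'⟩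
      algebraMap_mem' := fun r => ⟨0, LipschitzWith.const _⟩ }
  have hS : S.SeparatesPoints := by
    intro x y hxy
    refine ⟨_, ⟨⟨fun z => dist z y, by fun_prop⟩, ⟨1, LipschitzWith.dist_left y⟩, rfl⟩, ?_⟩
    simpa using hxy
  obtain ⟨⟨g, hg⟩, h⟩ :=
    ContinuousMap.exists_mem_subalgebra_near_continuousMap_of_separatesPoints S hS f ε hε
  refine ⟨g, hg, fun x => ?_⟩
  rw [abs_sub_comm]
  exact ((g - f).norm_coe_le_norm x).trans h.le

theorem isCompact_setOf_lipschitz_bounded {X : Type u} [MetricSpace X] [CompactSpace X]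
    {E : Type*} [NormedAddCommGroup E] [ProperSpace E] (R : ℝ) (K : NNReal) :
    IsCompact {c : C(X, E) | (∀ x, ‖c x‖ ≤ R) ∧ LipschitzWith K c} := by
  refine ArzelaAscoli.isCompact_of_equicontinuous _ ?_ ?_
  · have heq : ContinuousMap.toFun '' {c : C(X, E) | (∀ x, ‖c x‖ ≤ R) ∧ LipschitzWith K c} =
        Set.pi Set.univ (fun _ : X => Metric.closedBall (0 : E) R) ∩
          ⋂ (x : X) (y : X), {f | dist (f x) (f y) ≤ K * dist x y} := by
      ext f
      constructor
      · rintro ⟨c, ⟨h1, h2⟩, rfl⟩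
        refine ⟨fun x _ => by simpa using h1 x, ?_⟩
        simp only [Set.mem_iInter]
        exact fun x y => h2.dist_le_mul x y
      · rintro ⟨h1, h2⟩
        simp only [Set.mem_iInter] at h2
        have hf : LipschitzWith K f := LipschitzWith.of_dist_le_mul fun x y => h2 x y
        exact ⟨⟨f, hf.continuous⟩, ⟨fun x => by simpa using h1 x trivial, hf⟩, rfl⟩
    rw [heq]
    refine (isCompact_univ_pi fun _ => isCompact_closedBall _ _).inter_right ?_
    exact isClosed_iInter fun x => isClosed_iInter fun y =>
      isClosed_le ((continuous_apply x).dist (continuous_apply y)) continuous_const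
  · exact (LipschitzWith.uniformEquicontinuous _ K fun c => c.2.2).equicontinuous

/-- A Lipschitz function on a compact space isometrically embedded in `Z` extends to any other
subspace of `Z` without increasing its range or its Lipschitz constant. -/
theorem exists_lipschitz_extension {X Y Z : Type*} [MetricSpace X] [CompactSpace X] [Nonempty X]
    [MetricSpace Y] [MetricSpace Z] {Φ : X → Z} {Ψ : Y → Z} (hΦ : Isometry Φ) (hΨ : Isometry Ψ)
    {f : X → ℝ} (hf : LipschitzWith 1 f) :
    ∃ g : Y → ℝ, LipschitzWith 1 g ∧ (∀ x y, |f x - g y| ≤ dist (Φ x) (Ψ y)) ∧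
      ∀ r c : ℝ, (∀ x, |f x - r| ≤ c) → ∀ y, |g y - r| ≤ c := by
  obtain ⟨x₀, -, h₀⟩ := isCompact_univ.exists_isMinOn Set.univ_nonempty hf.continuous.continuousOn
  obtain ⟨x₁, -, h₁⟩ := isCompact_univ.exists_isMaxOn Set.univ_nonempty hf.continuous.continuousOn
  have hmin : ∀ x, f x₀ ≤ f x := fun x => h₀ (Set.mem_univ x)
  have hmax : ∀ x, f x ≤ f x₁ := fun x => h₁ (Set.mem_univ x)
  obtain ⟨h, hh, hhf⟩ : ∃ h : Z → ℝ, LipschitzWith 1 h ∧ ∀ x, h (Φ x) = f x := by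
    have : LipschitzOnWith 1 (Function.extend Φ f 0) (Set.range Φ) := by
      rintro _ ⟨x, rfl⟩ _ ⟨y, rfl⟩
      rw [hΦ.injective.extend_apply, hΦ.injective.extend_apply, hΦ.edist_eq]
      exact hf x y
    obtain ⟨h, hh, heq⟩ := this.extend_real
    exact ⟨h, hh, fun x => (heq ⟨x, rfl⟩).symm.trans (hΦ.injective.extend_apply _ _ _)⟩
  -- Truncating the McShane extension to `[min f, max f]` keeps it within `c` of any `r` that is
  -- within `c` of `f`; this later controls the scalar part of the Lip-norm.
  have hk : LipschitzWith 1 fun z => max (f x₀) (min (f x₁) (h z)) :=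
    (hh.const_min (f x₁)).const_max (f x₀)
  refine ⟨fun y => max (f x₀) (min (f x₁) (h (Ψ y))), ?_, fun x y => ?_, fun r c hr y => ?_⟩
  · exact (hk.comp hΨ.lipschitz).weaken (mul_one 1).le
  · have h2 := hk.dist_le_mul (Φ x) (Ψ y)
    rw [hhf, min_eq_right (hmax x), max_eq_right (hmin x), Real.dist_eq] at h2
    simpa using h2
  · have h2 := abs_le.1 (hr x₀)
    have h3 := abs_le.1 (hr x₁)
    rw [abs_le]
    have h4 : f x₀ ≤ max (f x₀) (min (f x₁) (h (Ψ y))) := le_max_left _ _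
    have h5 : max (f x₀) (min (f x₁) (h (Ψ y))) ≤ f x₁ := max_le (hmin _) (min_le_left _ _)
    constructor <;> linarith

end Lipschitz

/-! ### The Lip-norms -/

section LipNorm

variable {n : ℕ} {m : Fin (n + 1) → ℕ} {X : Type u} [MetricSpace X]

/-- The Lipschitz constant of `a` for the entrywise norm. -/
noncomputable def lipConst (a : C(X, FDAlg m)) : ℝ≥0∞ :=
  ⨆ (x : X) (y : X) (_ : x ≠ y), realMaxNorm (a x - a y) / edist x y

/-- The distance from `a` to the constant real multiples of the unit, for the entrywise norm. -/
noncomputable def scalarDist (a : C(X, FDAlg m)) : ℝ≥0∞ :=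
  ⨅ r : ℝ, ⨆ x : X, realMaxNorm (a x - r • (1 : FDAlg m))

theorem lipConst_le_iff {a : C(X, FDAlg m)} {c : ℝ≥0∞} :
    lipConst a ≤ c ↔ ∀ x y, realMaxNorm (a x - a y) ≤ c * edist x y := by
  simp only [lipConst, iSup_le_iff]
  refine forall₂_congr fun x y => ?_
  by_cases h : x = y
  · simp [h, realMaxNorm_zero]
  · simp only [ne_eq, h, not_false_eq_true, forall_const]
    exact ENNReal.div_le_iff (by simpa using h) (edist_ne_top x y)

theorem realMaxNorm_sub_le_lipConst (a : C(X, FDAlg m)) (x y : X) :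
    realMaxNorm (a x - a y) ≤ lipConst a * edist x y :=
  lipConst_le_iff.1 le_rfl x y

theorem lipConst_add_le (a b : C(X, FDAlg m)) : lipConst (a + b) ≤ lipConst a + lipConst b := by
  refine lipConst_le_iff.2 fun x y => ?_
  rw [ContinuousMap.add_apply, ContinuousMap.add_apply, add_sub_add_comm, add_mul]
  exact (realMaxNorm_add_le _ _).trans
    (add_le_add (realMaxNorm_sub_le_lipConst a x y) (realMaxNorm_sub_le_lipConst b x y))

theorem lipConst_smul_le (r : ℝ) (a : C(X, FDAlg m)) : lipConst (r • a) ≤ ‖r‖ₑ * lipConst a := by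
  refine lipConst_le_iff.2 fun x y => ?_
  rw [ContinuousMap.smul_apply, ContinuousMap.smul_apply, ← smul_sub, realMaxNorm_smul, mul_assoc]
  gcongr
  exact realMaxNorm_sub_le_lipConst a x y

theorem scalarDist_add_le (a b : C(X, FDAlg m)) :
    scalarDist (a + b) ≤ scalarDist a + scalarDist b := by
  simp only [scalarDist, ENNReal.iInf_add, ENNReal.add_iInf]
  refine le_iInf fun s => le_iInf fun r => iInf_le_of_le (r + s) (iSup_le fun x => ?_)
  have : (a + b) x - (r + s) • (1 : FDAlg m) =
      (a x - r • (1 : FDAlg m)) + (b x - s • (1 : FDAlg m)) := by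
    rw [ContinuousMap.add_apply, add_smul, add_sub_add_comm]
  rw [this]
  exact (realMaxNorm_add_le _ _).trans
    (add_le_add (le_iSup_of_le x le_rfl) (le_iSup_of_le x le_rfl))

theorem scalarDist_smul_le {r : ℝ} (hr : r ≠ 0) (a : C(X, FDAlg m)) :
    scalarDist (r • a) ≤ ‖r‖ₑ * scalarDist a := by
  rw [scalarDist, scalarDist, ENNReal.mul_iInf_of_ne (by simpa using hr) enorm_ne_top]
  refine le_iInf fun s => iInf_le_of_le (r * s) ?_
  rw [ENNReal.mul_iSup]
  refine iSup_mono fun x => ?_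
  rw [ContinuousMap.smul_apply, mul_smul, ← smul_sub, realMaxNorm_smul]

theorem continuous_realMaxNorm : Continuous (realMaxNorm : FDAlg m → ℝ≥0∞) := by
  refine continuous_of_le_add_edist 1 (by simp) fun v w => ?_
  rw [one_mul, edist_eq_enorm_sub]
  calc realMaxNorm v = realMaxNorm (w + (v - w)) := by rw [add_sub_cancel]
    _ ≤ realMaxNorm w + realMaxNorm (v - w) := realMaxNorm_add_le _ _
    _ ≤ _ := by gcongr; exact realMaxNorm_le_enorm _

variable [CompactSpace X]

theorem lipNorm_eq (a : selfAdjoint C(X, FDAlg m)) :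
    lipNorm m X a = max (lipConst (a : C(X, FDAlg m))) (scalarDist (a : C(X, FDAlg m))) := rfl

theorem scalarDist_le_enorm (a : C(X, FDAlg m)) : scalarDist a ≤ ‖a‖ₑ := by
  refine iInf_le_of_le 0 (iSup_le fun x => ?_)
  rw [zero_smul, sub_zero]
  refine (realMaxNorm_le_enorm _).trans ?_
  rw [enorm_le_iff_norm_le]
  exact a.norm_coe_le_norm x

/-- The Lipschitz part has sublevel sets cut out by closed pointwise conditions. The scalar part is
even `1`-Lipschitz, being subadditive and dominated by the norm. -/
theorem lowerSemicontinuous_lipNorm : LowerSemicontinuous (lipNorm m X) := by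
  have h1 : LowerSemicontinuous (lipConst : C(X, FDAlg m) → ℝ≥0∞) := by
    rw [lowerSemicontinuous_iff_isClosed_preimage]
    intro c
    have : lipConst ⁻¹' Set.Iic c = ⋂ (x : X) (y : X),
        {a : C(X, FDAlg m) | realMaxNorm (a x - a y) ≤ c * edist x y} := by
      ext a; simp [lipConst_le_iff]
    rw [this]
    refine isClosed_iInter fun x => isClosed_iInter fun y => isClosed_le ?_ continuous_const
    exact continuous_realMaxNorm.comp
      ((continuous_eval_const x).sub (continuous_eval_const y))
  have h2 : Continuous (scalarDist : C(X, FDAlg m) → ℝ≥0∞) := by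
    refine continuous_of_le_add_edist 1 (by simp) fun a b => ?_
    rw [one_mul, edist_eq_enorm_sub]
    calc scalarDist a = scalarDist (b + (a - b)) := by rw [add_sub_cancel]
      _ ≤ scalarDist b + scalarDist (a - b) := scalarDist_add_le _ _
      _ ≤ _ := by gcongr; exact scalarDist_le_enorm _
  exact (h1.sup h2.lowerSemicontinuous).comp continuous_subtype_val

theorem realMaxNorm_one_le : realMaxNorm (1 : FDAlg m) ≤ 1 := by
  rw [← ENNReal.ofReal_one, realMaxNorm_le_iff zero_le_one]
  intro l j k
  by_cases h : j = k <;> simp [Matrix.one_apply, h]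

/-- The distance from `a` to the constant real multiples of the unit is attained. -/
theorem exists_scalarDist (a : C(X, FDAlg m)) :
    ∃ r : ℝ, |r| ≤ ‖a‖ ∧ ∀ x, realMaxNorm (a x - r • (1 : FDAlg m)) ≤ scalarDist a := by
  let F : ℝ → ℝ≥0∞ := fun r => ⨆ x : X, realMaxNorm (a x - r • (1 : FDAlg m))
  have hF : Continuous F := by
    refine continuous_of_le_add_edist 1 (by simp) fun r s => iSup_le fun x => ?_
    have : a x - r • (1 : FDAlg m) = (a x - s • (1 : FDAlg m)) + (s - r) • (1 : FDAlg m) := by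
      rw [sub_smul]; abel
    rw [this]
    refine (realMaxNorm_add_le _ _).trans (add_le_add (le_iSup_of_le x le_rfl) ?_)
    rw [realMaxNorm_smul, edist_comm, edist_eq_enorm_sub, mul_comm]
    gcongr
    exact realMaxNorm_one_le
  obtain ⟨r, hr, hmin⟩ := (isCompact_Icc (a := -‖a‖) (b := ‖a‖)).exists_isMinOn
    ⟨0, by simp⟩ hF.continuousOn
  refine ⟨r, abs_le.2 hr, fun x => (le_iSup_of_le x le_rfl : _ ≤ F r).trans (le_iInf fun s => ?_)⟩
  -- Clamping `s` to `[-‖a‖, ‖a‖]` does no harm: `s` only affects real parts of diagonal entries,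
  -- and these lie in that interval.
  have hs : max (-‖a‖) (min ‖a‖ s) ∈ Set.Icc (-‖a‖) ‖a‖ :=
    ⟨le_max_left _ _, max_le (by linarith [norm_nonneg a]) (min_le_left _ _)⟩
  refine (hmin hs).trans (iSup_mono fun x => iSup_mono fun l => iSup₂_mono fun j k =>
    ENNReal.ofReal_le_ofReal ?_)
  by_cases h : j = k
  · subst h
    have h1 : |(a x l j j).re| ≤ ‖a‖ := (Complex.abs_re_le_norm _).trans
      (((norm_entry_le_l2_opNorm _ _ _).trans (norm_le_pi_norm (a x) l)).trans
        (a.norm_coe_le_norm x))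
    have h2 := abs_le.1 h1
    have h3 : |(a x l j j).re - max (-‖a‖) (min ‖a‖ s)| ≤ |(a x l j j).re - s| := by
      rcases max_cases (-‖a‖) (min ‖a‖ s) with ⟨e, h4⟩ | ⟨e, h4⟩ <;>
      rcases min_cases ‖a‖ s with ⟨e', h5⟩ | ⟨e', h5⟩ <;>
      rw [e] <;> (try rw [e']) <;>
      rcases abs_cases ((a x l j j).re - s) with ⟨e2, h6⟩ | ⟨e2, h6⟩ <;> rw [e2, abs_le] <;>
      constructor <;> linarith
    simpa using max_le_max h3 le_rfl
  · simp [h]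

theorem lipNorm_add_le (a b : selfAdjoint C(X, FDAlg m)) :
    lipNorm m X (a + b) ≤ lipNorm m X a + lipNorm m X b := by
  simp only [lipNorm_eq]
  exact max_le ((lipConst_add_le _ _).trans (add_le_add (le_max_left _ _) (le_max_left _ _)))
    ((scalarDist_add_le _ _).trans (add_le_add (le_max_right _ _) (le_max_right _ _)))

theorem lipNorm_eq_zero_iff (a : selfAdjoint C(X, FDAlg m)) :
    lipNorm m X a = 0 ↔ ∃ r : ℝ, a = r • (1 : selfAdjoint C(X, FDAlg m)) := by
  constructor
  · intro h
    obtain ⟨r, -, hr⟩ := exists_scalarDist (a : C(X, FDAlg m))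
    have h0 : scalarDist (a : C(X, FDAlg m)) = 0 :=
      le_antisymm ((le_max_right _ _).trans_eq h) bot_le
    refine ⟨r, Subtype.ext (ContinuousMap.ext fun x => sub_eq_zero.1 ?_)⟩
    have h1 := (enorm_le_realMaxNorm _).trans (mul_le_mul_right (hr x) _)
    rw [h0, mul_zero, nonpos_iff_eq_zero, enorm_eq_zero] at h1
    exact h1
  · rintro ⟨r, rfl⟩
    have hx : ∀ x, ((r • (1 : selfAdjoint C(X, FDAlg m)) : selfAdjoint C(X, FDAlg m)) :
        C(X, FDAlg m)) x = r • (1 : FDAlg m) := fun x => rfl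
    refine le_antisymm (max_le (lipConst_le_iff.2 fun x y => ?_)
      (iInf_le_of_le r (iSup_le fun x => ?_))) bot_le
    · rw [hx, hx, sub_self, realMaxNorm_zero]; exact bot_le
    · rw [hx, sub_self, realMaxNorm_zero]

theorem lipNorm_smul (r : ℝ) (a : selfAdjoint C(X, FDAlg m)) :
    lipNorm m X (r • a) = ‖r‖ₑ * lipNorm m X a := by
  rcases eq_or_ne r 0 with rfl | hr
  · rw [(lipNorm_eq_zero_iff _).2 ⟨0, Subtype.ext ?_⟩]
    · simp
    · exact (zero_smul ℝ (a : C(X, FDAlg m))).trans (zero_smul ℝ (1 : C(X, FDAlg m))).symm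
  have key : ∀ {s : ℝ} (_ : s ≠ 0) (b : selfAdjoint C(X, FDAlg m)),
      lipNorm m X (s • b) ≤ ‖s‖ₑ * lipNorm m X b := fun {s} hs b =>
    max_le ((lipConst_smul_le s _).trans (mul_le_mul_right (le_max_left _ _) _))
      ((scalarDist_smul_le hs _).trans (mul_le_mul_right (le_max_right _ _) _))
  refine le_antisymm (key hr a) ?_
  have h := key (inv_ne_zero hr) (r • a)
  rw [inv_smul_smul₀ hr] at h
  calc ‖r‖ₑ * lipNorm m X a ≤ ‖r‖ₑ * (‖r⁻¹‖ₑ * lipNorm m X (r • a)) := by gcongr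
    _ = lipNorm m X (r • a) := by
      rw [← mul_assoc, ← enorm_mul, mul_inv_cancel₀ hr, enorm_one, one_mul]

end LipNorm

/-! ### The quasi-Leibniz property -/

section Leibniz

theorem enorm_le_of_norm_le_mul_add_mul {E F : Type*} [SeminormedAddCommGroup E]
    [SeminormedAddCommGroup F] {a b : E} {z u v : F} (h : ‖z‖ ≤ ‖a‖ * ‖u‖ + ‖b‖ * ‖v‖) :
    ‖z‖ₑ ≤ ‖a‖ₑ * ‖u‖ₑ + ‖b‖ₑ * ‖v‖ₑ := by
  simp only [enorm, ← ENNReal.coe_mul, ← ENNReal.coe_add, ENNReal.coe_le_coe]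
  exact h

variable {E : Type*} [NormedRing E]

theorem norm_mul_sub_mul_le {a b a' b' : E} {N M : ℝ} (ha : ‖a‖ ≤ N) (hb' : ‖b'‖ ≤ M) :
    ‖a * b - a' * b'‖ ≤ N * ‖b - b'‖ + M * ‖a - a'‖ := by
  calc ‖a * b - a' * b'‖ = ‖a * (b - b') + (a - a') * b'‖ := by congr 1; noncomm_ring
    _ ≤ ‖a‖ * ‖b - b'‖ + ‖a - a'‖ * ‖b'‖ :=
      (norm_add_le _ _).trans (add_le_add (norm_mul_le _ _) (norm_mul_le _ _))
    _ ≤ N * ‖b - b'‖ + ‖a - a'‖ * M := by gcongr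
    _ = _ := by ring

variable [NormedAlgebra ℂ E]

theorem norm_jordan_sub_le {a b a' b' : E} {N M : ℝ} (ha : ‖a‖ ≤ N) (ha' : ‖a'‖ ≤ N)
    (hb : ‖b‖ ≤ M) (hb' : ‖b'‖ ≤ M) :
    ‖(1 / 2 : ℂ) • (a * b + b * a) - (1 / 2 : ℂ) • (a' * b' + b' * a')‖ ≤
      N * ‖b - b'‖ + M * ‖a - a'‖ := by
  have h1 := norm_mul_sub_mul_le (b := b) (a' := a') ha hb'
  have h2 := norm_mul_sub_mul_le (b := a) (a' := b') hb ha'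
  rw [← smul_sub, norm_smul, add_sub_add_comm]
  have h3 := norm_add_le (a * b - a' * b') (b * a - b' * a')
  have h4 : ‖(1 / 2 : ℂ)‖ = 1 / 2 := by simp
  rw [h4]
  linarith

theorem norm_lie_sub_le {a b a' b' : E} {N M : ℝ} (ha : ‖a‖ ≤ N) (ha' : ‖a'‖ ≤ N)
    (hb : ‖b‖ ≤ M) (hb' : ‖b'‖ ≤ M) :
    ‖(1 / (2 * Complex.I) : ℂ) • (a * b - b * a) -
        (1 / (2 * Complex.I) : ℂ) • (a' * b' - b' * a')‖ ≤
      N * ‖b - b'‖ + M * ‖a - a'‖ := by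
  have h1 := norm_mul_sub_mul_le (b := b) (a' := a') ha hb'
  have h2 := norm_mul_sub_mul_le (b := a) (a' := b') hb ha'
  rw [← smul_sub, norm_smul, sub_sub_sub_comm]
  have h3 := norm_sub_le (a * b - a' * b') (b * a - b' * a')
  have h4 : ‖(1 / (2 * Complex.I) : ℂ)‖ = 1 / 2 := by simp
  rw [h4]
  linarith

variable {n : ℕ} {m : Fin (n + 1) → ℕ} {X : Type u} [MetricSpace X] [CompactSpace X]

/-- The quasi-Leibniz inequality for a product `P` which is bounded like the multiplication and
preserves the real multiples of the unit. -/
theorem max_lipConst_scalarDist_le_of_product (P : FDAlg m → FDAlg m → FDAlg m)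
    (hP : ∀ {u v u' v' : FDAlg m} {N M : ℝ}, ‖u‖ ≤ N → ‖u'‖ ≤ N → ‖v‖ ≤ M → ‖v'‖ ≤ M →
      ‖P u v - P u' v'‖ ≤ N * ‖v - v'‖ + M * ‖u - u'‖)
    (hP1 : ∀ r s : ℝ, ∃ t : ℝ, P (r • 1) (s • 1) = t • 1) (a b p : C(X, FDAlg m))
    (hp : ∀ x, p x = P (a x) (b x)) :
    max (lipConst p) (scalarDist p) ≤ ENNReal.ofReal (√2 * maxSize m) *
      (‖a‖ₑ * max (lipConst b) (scalarDist b) + ‖b‖ₑ * max (lipConst a) (scalarDist a)) := by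
  set C := ENNReal.ofReal (√2 * maxSize m)
  have key : ∀ {u v u' v' : FDAlg m} {c d : ℝ≥0∞}, ‖u‖ ≤ ‖a‖ → ‖u'‖ ≤ ‖a‖ → ‖v‖ ≤ ‖b‖ →
      ‖v'‖ ≤ ‖b‖ → realMaxNorm (v - v') ≤ c → realMaxNorm (u - u') ≤ d →
      realMaxNorm (P u v - P u' v') ≤ C * (‖a‖ₑ * c + ‖b‖ₑ * d) := by
    intro u v u' v' c d hu hu' hv hv' hc hd
    calc realMaxNorm (P u v - P u' v') ≤ ‖P u v - P u' v'‖ₑ := realMaxNorm_le_enorm _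
      _ ≤ ‖a‖ₑ * ‖v - v'‖ₑ + ‖b‖ₑ * ‖u - u'‖ₑ :=
        enorm_le_of_norm_le_mul_add_mul (hP hu hu' hv hv')
      _ ≤ ‖a‖ₑ * (C * c) + ‖b‖ₑ * (C * d) := by
        gcongr
        · exact (enorm_le_realMaxNorm _).trans (mul_le_mul_right hc _)
        · exact (enorm_le_realMaxNorm _).trans (mul_le_mul_right hd _)
      _ = C * (‖a‖ₑ * c + ‖b‖ₑ * d) := by ring
  have hna := a.norm_coe_le_norm
  have hnb := b.norm_coe_le_norm
  refine max_le (lipConst_le_iff.2 fun x y => ?_) ?_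
  · rw [hp, hp]
    refine (key (hna x) (hna y) (hnb x) (hnb y)
      (realMaxNorm_sub_le_lipConst b x y) (realMaxNorm_sub_le_lipConst a x y)).trans ?_
    rw [← mul_assoc, ← mul_assoc, ← add_mul, ← mul_assoc]
    gcongr
    · exact le_max_left _ _
    · exact le_max_left _ _
  -- The bounds `|r| ≤ ‖a‖` and `|s| ≤ ‖b‖` put `r1` and `s1` in the balls where `key` applies;
  -- their product `t1` then competes in the infimum.
  · obtain ⟨r, hr, har⟩ := exists_scalarDist a
    obtain ⟨s, hs, hbs⟩ := exists_scalarDist b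
    obtain ⟨t, ht⟩ := hP1 r s
    have h1 : ∀ q : ℝ, ‖q • (1 : FDAlg m)‖ ≤ |q| := by
      intro q
      rw [norm_smul, Real.norm_eq_abs]
      refine mul_le_of_le_one_right (abs_nonneg q) ?_
      rcases subsingleton_or_nontrivial (FDAlg m) with h | h
      · simp [Subsingleton.elim (1 : FDAlg m) 0]
      · rw [CStarRing.norm_one]
    refine iInf_le_of_le t (iSup_le fun x => ?_)
    rw [hp, ← ht]
    refine (key (hna x) ((h1 r).trans hr) (hnb x) ((h1 s).trans hs) (hbs x) (har x)).trans ?_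
    gcongr
    · exact le_max_right _ _
    · exact le_max_right _ _

theorem lipNorm_quasiLeibniz (a b : selfAdjoint C(X, FDAlg m)) :
    max (lipNorm m X (jordanMul a b)) (lipNorm m X (lieMul a b)) ≤
      ENNReal.ofReal (√2 * maxSize m) *
        (‖(a : C(X, FDAlg m))‖ₑ * lipNorm m X b + ‖(b : C(X, FDAlg m))‖ₑ * lipNorm m X a) := by
  refine max_le ?_ ?_
  · refine max_lipConst_scalarDist_le_of_product
      (fun u v : FDAlg m => (1 / 2 : ℂ) • (u * v + v * u))
      (fun h1 h2 h3 h4 => norm_jordan_sub_le h1 h2 h3 h4)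
      (fun r s => ⟨r * s, ?_⟩) (a : C(X, FDAlg m)) b _ fun x => rfl
    simp only [smul_mul_smul_comm, mul_one, mul_comm s r, ← two_smul ℂ, smul_smul]
    norm_num
  · refine max_lipConst_scalarDist_le_of_product
      (fun u v : FDAlg m => (1 / (2 * Complex.I) : ℂ) • (u * v - v * u))
      (fun h1 h2 h3 h4 => norm_lie_sub_le h1 h2 h3 h4)
      (fun r s => ⟨0, ?_⟩) (a : C(X, FDAlg m)) b _ fun x => rfl
    simp only [smul_mul_smul_comm, mul_one, mul_comm s r, sub_self, smul_zero, zero_smul]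

end Leibniz

/-! ### Symmetrization of matrix-valued functions -/

section Symmetrize

variable {n : ℕ} {m : Fin (n + 1) → ℕ} {X : Type u} [MetricSpace X]

/-- The matrix-valued function with given real and imaginary parts of the entries. -/
noncomputable def ofParts (p q : ∀ l, Fin (m l) → Fin (m l) → C(X, ℝ)) : C(X, FDAlg m) where
  toFun x l := Matrix.of fun j k => (⟨p l j k x, q l j k x⟩ : ℂ)
  continuous_toFun := by
    refine continuous_pi fun l => continuous_matrix fun j k => ?_
    have : (fun x => (⟨p l j k x, q l j k x⟩ : ℂ)) =
        fun x => (p l j k x : ℂ) + (q l j k x : ℂ) * Complex.I := by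
      funext x; exact Complex.mk_eq_add_mul_I _ _
    simp only [Matrix.of_apply]
    rw [this]
    fun_prop

theorem lipConst_ofParts_le {p q : ∀ l, Fin (m l) → Fin (m l) → C(X, ℝ)} {K : NNReal}
    (hp : ∀ l j k, LipschitzWith K (p l j k)) (hq : ∀ l j k, LipschitzWith K (q l j k)) :
    lipConst (ofParts p q) ≤ K := by
  refine lipConst_le_iff.2 fun x y => ?_
  rw [edist_dist, ← ENNReal.ofReal_coe_nnreal, ← ENNReal.ofReal_mul (NNReal.coe_nonneg K),
    realMaxNorm_le_iff (by positivity)]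
  exact fun l j k => ⟨(hp l j k).dist_le_mul x y, (hq l j k).dist_le_mul x y⟩

variable [CompactSpace X]

theorem realPart_apply (w : C(X, FDAlg m)) (x : X) :
    (realPart w : C(X, FDAlg m)) x = (2⁻¹ : ℝ) • (w x + star (w x)) := by
  rw [realPart_apply_coe]; rfl

/-- Approximants built entry by entry need not be self-adjoint; this lets them be symmetrized
without losing accuracy. -/
theorem realMaxNorm_sub_realPart_le (w : C(X, FDAlg m)) (x : X) {v : FDAlg m}
    (hv : IsSelfAdjoint v) :
    realMaxNorm (v - (realPart w : C(X, FDAlg m)) x) ≤ realMaxNorm (v - w x) := by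
  have : v - (realPart w : C(X, FDAlg m)) x = (2⁻¹ : ℝ) • ((v - w x) + star (v - w x)) := by
    rw [realPart_apply, star_sub, hv.star_eq]
    module
  rw [this]
  exact realMaxNorm_half_add_star_le _

theorem realMaxNorm_realPart_sub_le (w : C(X, FDAlg m)) (x : X) {v : FDAlg m}
    (hv : IsSelfAdjoint v) :
    realMaxNorm ((realPart w : C(X, FDAlg m)) x - v) ≤ realMaxNorm (w x - v) := by
  have : (realPart w : C(X, FDAlg m)) x - v = (2⁻¹ : ℝ) • ((w x - v) + star (w x - v)) := by
    rw [realPart_apply, star_sub, hv.star_eq]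
    module
  rw [this]
  exact realMaxNorm_half_add_star_le _

theorem lipConst_realPart_le (w : C(X, FDAlg m)) :
    lipConst (realPart w : C(X, FDAlg m)) ≤ lipConst w := by
  refine lipConst_le_iff.2 fun x y => le_trans ?_ (realMaxNorm_sub_le_lipConst w x y)
  have : (realPart w : C(X, FDAlg m)) x - (realPart w : C(X, FDAlg m)) y =
      (2⁻¹ : ℝ) • ((w x - w y) + star (w x - w y)) := by
    rw [realPart_apply, realPart_apply, star_sub]
    module
  rw [this]
  exact realMaxNorm_half_add_star_le _

theorem dense_lipNorm_lt_top : Dense {a : selfAdjoint C(X, FDAlg m) | lipNorm m X a < ∞} := by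
  refine Metric.dense_iff.2 fun a ε hε => ?_
  set C := √2 * maxSize m
  have hC : 0 ≤ C := by positivity
  -- Chosen so that `C * η < ε`; the `+ 1` covers `C = 0`, as empty blocks are not excluded here.
  set η := ε / (2 * (C + 1))
  have hη : 0 < η := by positivity
  have hre : ∀ l j k, ∃ g : C(X, ℝ), (∃ K, LipschitzWith K g) ∧
      ∀ x, |((a : C(X, FDAlg m)) x l j k).re - g x| ≤ η := fun l j k =>
    exists_lipschitzWith_abs_sub_le
      ⟨fun x => ((a : C(X, FDAlg m)) x l j k).re, by fun_prop⟩ hη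
  have him : ∀ l j k, ∃ g : C(X, ℝ), (∃ K, LipschitzWith K g) ∧
      ∀ x, |((a : C(X, FDAlg m)) x l j k).im - g x| ≤ η := fun l j k =>
    exists_lipschitzWith_abs_sub_le
      ⟨fun x => ((a : C(X, FDAlg m)) x l j k).im, by fun_prop⟩ hη
  choose p hpK hp using hre
  choose q hqK hq using him
  choose Kp hKp using hpK
  choose Kq hKq using hqK
  obtain ⟨K, hK⟩ := Finite.exists_le
    (fun i : Σ l, Fin (m l) × Fin (m l) => max (Kp i.1 i.2.1 i.2.2) (Kq i.1 i.2.1 i.2.2))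
  refine ⟨realPart (ofParts p q), ?_, ?_⟩
  · rw [Metric.mem_ball, dist_comm, Subtype.dist_eq, dist_eq_norm]
    have : ‖(a : C(X, FDAlg m)) - (realPart (ofParts p q) : C(X, FDAlg m))‖ ≤ C * η := by
      refine (ContinuousMap.norm_le _ (by positivity)).2 fun x => ?_
      have hax : IsSelfAdjoint ((a : C(X, FDAlg m)) x) :=
        congrArg (fun f : C(X, FDAlg m) => f x) (selfAdjoint.mem_iff.1 a.2)
      have h1 : realMaxNorm ((a : C(X, FDAlg m)) x - ofParts p q x) ≤ ENNReal.ofReal η :=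
        (realMaxNorm_le_iff hη.le).2 fun l j k => ⟨hp l j k x, hq l j k x⟩
      have h2 := (enorm_le_realMaxNorm _).trans
        (mul_le_mul_right ((realMaxNorm_sub_realPart_le (ofParts p q) x hax).trans h1)
          (ENNReal.ofReal C))
      rw [← ENNReal.ofReal_mul hC, ← ofReal_norm] at h2
      exact (ENNReal.ofReal_le_ofReal_iff (by positivity)).1 h2
    refine this.trans_lt ?_
    rw [mul_div_assoc', div_lt_iff₀ (by positivity)]
    nlinarith
  · refine max_lt ?_ ((scalarDist_le_enorm _).trans_lt enorm_lt_top)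
    refine (lipConst_realPart_le _).trans_lt ((lipConst_ofParts_le (K := K) ?_ ?_).trans_lt
      ENNReal.coe_lt_top)
    · exact fun l j k => (hKp l j k).weaken ((le_max_left _ _).trans (hK ⟨l, j, k⟩))
    · exact fun l j k => (hKq l j k).weaken ((le_max_right _ _).trans (hK ⟨l, j, k⟩))

theorem exists_finite_net_lipNorm_le_one {ε : ℝ} (hε : 0 < ε) :
    ∃ F : Set C(X, FDAlg m), F.Finite ∧ ∀ a : selfAdjoint C(X, FDAlg m), lipNorm m X a ≤ 1 →
      ∃ b ∈ F, ∃ r : ℝ, ‖(a : C(X, FDAlg m)) - (r : ℂ) • (1 : C(X, FDAlg m)) - b‖ ≤ ε := by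
  have hprop : ProperSpace (FDAlg m) := FiniteDimensional.proper ℂ (FDAlg m)
  set C : NNReal := Real.toNNReal (√2 * maxSize m)
  have hK := isCompact_setOf_lipschitz_bounded (X := X) (E := FDAlg m) C C
  obtain ⟨F, hF, hcov⟩ := Metric.totallyBounded_iff.1 hK.totallyBounded ε hε
  refine ⟨F, hF, fun a ha => ?_⟩
  obtain ⟨r, -, hr⟩ := exists_scalarDist (a : C(X, FDAlg m))
  set c : C(X, FDAlg m) := (a : C(X, FDAlg m)) - (r : ℂ) • (1 : C(X, FDAlg m)) with hc
  have hcx : ∀ x, c x = (a : C(X, FDAlg m)) x - r • (1 : FDAlg m) := fun x =>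
    congrArg (fun v => (a : C(X, FDAlg m)) x - v) (Complex.coe_smul r (1 : FDAlg m))
  -- Once the best scalar is removed, the two halves of the Lip-norm bound size and Lipschitz
  -- constant by `1` entrywise, so by `C` in the C*-norm.
  have hmem : c ∈ {c : C(X, FDAlg m) | (∀ x, ‖c x‖ ≤ C) ∧ LipschitzWith C c} := by
    refine ⟨fun x => ?_, fun x y => ?_⟩
    · have h1 := (enorm_le_realMaxNorm (c x)).trans (mul_le_mul_right
        (((hcx x) ▸ hr x).trans ((le_max_right _ _).trans ha)) _)
      rw [mul_one] at h1
      exact ENNReal.coe_le_coe.1 h1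
    · have h1 := (realMaxNorm_sub_le_lipConst (a : C(X, FDAlg m)) x y).trans
        (mul_le_mul_left ((le_max_left _ _).trans ha) _)
      rw [one_mul] at h1
      have h2 : c x - c y = (a : C(X, FDAlg m)) x - (a : C(X, FDAlg m)) y := by
        rw [hcx, hcx, sub_sub_sub_cancel_right]
      rw [edist_eq_enorm_sub, h2]
      exact (enorm_le_realMaxNorm _).trans (mul_le_mul_right h1 _)
  obtain ⟨b, hb, hcb⟩ := Set.mem_iUnion₂.1 (hcov hmem)
  refine ⟨b, hb, r, ?_⟩
  rw [← hc, ← dist_eq_norm]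
  exact (Metric.mem_ball.1 hcb).le

/-- `(C(X, 𝔄), L_X)` is a quasi-Leibniz compact quantum metric space. -/
theorem isQuasiLeibnizCQMS_lipNorm (hm : ∀ l, 0 < m l) [Nonempty X] :
    IsQuasiLeibnizCQMS C(X, FDAlg m) (√2 * maxSize m) 0 (lipNorm m X) where
  isCompactQuantumMetric :=
    { nontrivial := by
        have : ∀ l, Nonempty (Fin (m l)) := fun l => ⟨⟨0, hm l⟩⟩
        infer_instance
      add_le := lipNorm_add_le
      smul := lipNorm_smul
      dense_dom := dense_lipNorm_lt_top
      eq_zero_iff := lipNorm_eq_zero_iff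
      metrizes := hasBasis_nhds_mkDist lipNorm_smul dense_lipNorm_lt_top
        fun _ hε => exists_finite_net_lipNorm_le_one hε
      lsc := lowerSemicontinuous_lipNorm }
  one_le := by
    have h1 : (1 : ℝ) ≤ maxSize m := by
      exact_mod_cast (hm 0).trans_le (Finset.le_sup (f := m) (Finset.mem_univ 0))
    have h2 : (1 : ℝ) ≤ √2 := Real.one_le_sqrt.2 one_le_two
    exact one_le_mul_of_one_le_of_one_le h2 h1
  nonneg := le_rfl
  quasiLeibniz a b _ _ := by
    simpa using lipNorm_quasiLeibniz a b

end Symmetrize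

/-! ### Bridges with trivial pivot -/

section TrivialPivot

theorem levelSet_one (D : Type u) [CStarAlgebra D] : levelSet (1 : D) = stateSpace D := by
  ext φ
  simp [levelSet]

theorem hausdorffOf_self_eq_zero {α : Type u} {d : α → α → ℝ≥0∞} (hd : ∀ x, d x x = 0)
    (s : Set α) : hausdorffOf d s s = 0 := by
  refine le_antisymm (max_le ?_ ?_) bot_le
  · exact iSup₂_le fun x hx => iInf₂_le_of_le x hx (hd x).le
  · exact iSup₂_le fun x hx => iInf₂_le_of_le x hx (hd x).le

theorem setOf_comp_levelSet_one {A D : Type u} [CStarAlgebra A] [CStarAlgebra D] (ρ : A →⋆ₐ[ℂ] D)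
    (hρ : Function.Injective ρ) :
    {ψ : WeakDual ℂ A | ∃ φ ∈ levelSet (1 : D), ∀ a : A, ψ a = φ (ρ a)} = stateSpace A := by
  rw [levelSet_one]
  ext ψ
  exact ⟨fun ⟨φ, hφ, h⟩ => stateSpace.comp_mem ρ hφ h,
    fun h => stateSpace.exists_extension ρ hρ h⟩

variable {A B : Type u} [CStarAlgebra A] [CStarAlgebra B]

/-- The bridge with pivot `1` given by two unital *-monomorphisms. -/
def Bridge.ofInjective (D : Type u) [CStarAlgebra D] [Nontrivial D] (ρ : A →⋆ₐ[ℂ] D)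
    (σ : B →⋆ₐ[ℂ] D) (hρ : Function.Injective ρ) (hσ : Function.Injective σ) : Bridge A B where
  D := D
  pivot := 1
  left := ρ
  right := σ
  left_injective := hρ
  right_injective := hσ
  levelSet_nonempty := by rw [levelSet_one]; exact stateSpace_nonempty

theorem Bridge.height_ofInjective (D : Type u) [CStarAlgebra D] [Nontrivial D] (ρ : A →⋆ₐ[ℂ] D)
    (σ : B →⋆ₐ[ℂ] D) (hρ : Function.Injective ρ) (hσ : Function.Injective σ)
    (LA : selfAdjoint A → ℝ≥0∞) (LB : selfAdjoint B → ℝ≥0∞) :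
    (Bridge.ofInjective D ρ σ hρ hσ).height LA LB = 0 := by
  have h1 := setOf_comp_levelSet_one ρ hρ
  have h2 := setOf_comp_levelSet_one σ hσ
  change max (hausdorffOf (mkDist LA) (stateSpace A)
      {ψ | ∃ φ ∈ levelSet (1 : D), ∀ a : A, ψ a = φ (ρ a)})
    (hausdorffOf (mkDist LB) (stateSpace B)
      {ψ | ∃ φ ∈ levelSet (1 : D), ∀ b : B, ψ b = φ (σ b)}) = 0
  rw [h1, h2, hausdorffOf_self_eq_zero mkDist_self, hausdorffOf_self_eq_zero mkDist_self, max_self]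

theorem Bridge.reach_ofInjective_le (D : Type u) [CStarAlgebra D] [Nontrivial D] (ρ : A →⋆ₐ[ℂ] D)
    (σ : B →⋆ₐ[ℂ] D) (hρ : Function.Injective ρ) (hσ : Function.Injective σ)
    {LA : selfAdjoint A → ℝ≥0∞} {LB : selfAdjoint B → ℝ≥0∞} {c : ℝ≥0∞}
    (hA : ∀ a, LA a ≤ 1 → ∃ b, LB b ≤ 1 ∧ edist (ρ (a : A)) (σ (b : B)) ≤ c)
    (hB : ∀ b, LB b ≤ 1 → ∃ a, LA a ≤ 1 ∧ edist (ρ (a : A)) (σ (b : B)) ≤ c) :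
    (Bridge.ofInjective D ρ σ hρ hσ).reach LA LB ≤ c := by
  refine max_le (iSup₂_le ?_) (iSup₂_le ?_)
  · rintro _ ⟨a, ha, rfl⟩
    obtain ⟨b, hb, hab⟩ := hA a ha
    refine (iInf₂_le _ ⟨b, hb, rfl⟩).trans ?_
    change edist (ρ (a : A) * 1) (1 * σ (b : B)) ≤ c
    rwa [mul_one, one_mul]
  · rintro _ ⟨b, hb, rfl⟩
    obtain ⟨a, ha, hab⟩ := hB b hb
    refine (iInf₂_le _ ⟨a, ha, rfl⟩).trans ?_
    change edist (ρ (a : A) * 1) (1 * σ (b : B)) ≤ c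
    rwa [mul_one, one_mul]

end TrivialPivot

/-! ### Comparison of the propinquity with the Gromov-Hausdorff distance -/

section GromovHausdorff

variable {n : ℕ} {m : Fin (n + 1) → ℕ}

theorem exists_lipNorm_le_one_norm_sub_le {X Y : Type u} {Z : Type*} [MetricSpace X]
    [CompactSpace X] [Nonempty X] [MetricSpace Y] [CompactSpace Y] [MetricSpace Z] {Φ : X → Z}
    {Ψ : Y → Z} (hΦ : Isometry Φ) (hΨ : Isometry Ψ) {a : selfAdjoint C(X, FDAlg m)}
    (ha : lipNorm m X a ≤ 1) :
    ∃ b : selfAdjoint C(Y, FDAlg m), lipNorm m Y b ≤ 1 ∧ ∀ x y,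
      ‖(a : C(X, FDAlg m)) x - (b : C(Y, FDAlg m)) y‖ ≤
        √2 * maxSize m * dist (Φ x) (Ψ y) := by
  have hlip : ∀ x y l j k,
      |((a : C(X, FDAlg m)) x l j k).re - ((a : C(X, FDAlg m)) y l j k).re| ≤ dist x y ∧
      |((a : C(X, FDAlg m)) x l j k).im - ((a : C(X, FDAlg m)) y l j k).im| ≤ dist x y := by
    intro x y l j k
    have h := lipConst_le_iff.1 ((le_max_left _ _).trans ha) x y
    rw [one_mul, edist_dist, realMaxNorm_le_iff dist_nonneg] at h
    exact h l j k
  have hre : ∀ l j k, ∃ g : Y → ℝ, LipschitzWith 1 g ∧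
      (∀ x y, |((a : C(X, FDAlg m)) x l j k).re - g y| ≤ dist (Φ x) (Ψ y)) ∧
      ∀ r c : ℝ, (∀ x, |((a : C(X, FDAlg m)) x l j k).re - r| ≤ c) → ∀ y, |g y - r| ≤ c :=
    fun l j k => exists_lipschitz_extension hΦ hΨ
      (LipschitzWith.of_dist_le_mul fun x y => by simpa using! (hlip x y l j k).1)
  have him : ∀ l j k, ∃ g : Y → ℝ, LipschitzWith 1 g ∧
      (∀ x y, |((a : C(X, FDAlg m)) x l j k).im - g y| ≤ dist (Φ x) (Ψ y)) ∧
      ∀ r c : ℝ, (∀ x, |((a : C(X, FDAlg m)) x l j k).im - r| ≤ c) → ∀ y, |g y - r| ≤ c :=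
    fun l j k => exists_lipschitz_extension hΦ hΨ
      (LipschitzWith.of_dist_le_mul fun x y => by simpa using! (hlip x y l j k).2)
  choose p hpL hpd hpr using hre
  choose q hqL hqd hqr using him
  set w : C(Y, FDAlg m) := ofParts (fun l j k => ⟨p l j k, (hpL l j k).continuous⟩)
    (fun l j k => ⟨q l j k, (hqL l j k).continuous⟩) with hw
  refine ⟨realPart w, max_le ?_ ?_, fun x y => ?_⟩
  · exact (lipConst_realPart_le w).trans
      ((lipConst_ofParts_le (K := 1) hpL hqL).trans_eq ENNReal.coe_one)
  · refine le_trans ?_ ((le_max_right _ _).trans ha)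
    obtain ⟨r, -, hr⟩ := exists_scalarDist (a : C(X, FDAlg m))
    refine iInf_le_of_le r (iSup_le fun y => ?_)
    have hr1 : IsSelfAdjoint (r • (1 : FDAlg m)) := (IsSelfAdjoint.all r).smul (.one _)
    refine (realMaxNorm_realPart_sub_le w y hr1).trans ?_
    have hfin : scalarDist (a : C(X, FDAlg m)) ≠ ∞ :=
      ((scalarDist_le_enorm _).trans_lt enorm_lt_top).ne
    change _ ≤ scalarDist (a : C(X, FDAlg m))
    rw [← ENNReal.ofReal_toReal hfin] at hr ⊢
    rw [realMaxNorm_le_iff ENNReal.toReal_nonneg]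
    have hr' := fun x => (realMaxNorm_le_iff ENNReal.toReal_nonneg).1 (hr x)
    -- The reference values are the real and imaginary parts of the entries of `r1`, so one `r`
    -- serves every entry.
    exact fun l j k => ⟨hpr l j k _ _ (fun x => (hr' x l j k).1) y,
      hqr l j k _ _ (fun x => (hr' x l j k).2) y⟩
  · have hax : IsSelfAdjoint ((a : C(X, FDAlg m)) x) :=
      congrArg (fun f : C(X, FDAlg m) => f x) (selfAdjoint.mem_iff.1 a.2)
    have h1 : realMaxNorm ((a : C(X, FDAlg m)) x - w y) ≤ ENNReal.ofReal (dist (Φ x) (Ψ y)) :=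
      (realMaxNorm_le_iff dist_nonneg).2 fun l j k => ⟨hpd l j k x y, hqd l j k x y⟩
    have h2 := (enorm_le_realMaxNorm _).trans
      (mul_le_mul_right ((realMaxNorm_sub_realPart_le w y hax).trans h1)
        (ENNReal.ofReal (√2 * maxSize m)))
    rw [← ENNReal.ofReal_mul (by positivity), ← ofReal_norm] at h2
    exact (ENNReal.ofReal_le_ofReal_iff (by positivity)).1 h2

theorem propinquity_le_bridge_length {P Q : QLCQMS.{u}} (γ : Bridge P.carrier Q.carrier) :
    propinquity P Q ≤ γ.length P.L Q.L :=
  iInf_le_of_le (Trek.single γ) le_rfl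

theorem exists_dist_le_hausdorffDist {Z : Type*} [MetricSpace Z] {s t : Set Z} (hs : IsCompact s)
    (ht : IsCompact t) (hs' : s.Nonempty) (ht' : t.Nonempty) {x : Z} (hx : x ∈ s) :
    ∃ y ∈ t, dist x y ≤ Metric.hausdorffDist s t := by
  obtain ⟨y, hy, h⟩ := ht.exists_infDist_eq_dist ht' x
  refine ⟨y, hy, h ▸ Metric.infDist_le_hausdorffDist_of_mem hx ?_⟩
  exact Metric.hausdorffEDist_ne_top_of_nonempty_of_bounded hs' ht' hs.isBounded ht.isBounded

theorem propinquity_le_ghDist (hm : ∀ l, 0 < m l) (X Y : Type u) [MetricSpace X] [CompactSpace X]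
    [Nonempty X] [MetricSpace Y] [CompactSpace Y] [Nonempty Y] :
    propinquity (QLCQMS.of (isQuasiLeibnizCQMS_lipNorm (X := X) hm))
        (QLCQMS.of (isQuasiLeibnizCQMS_lipNorm (X := Y) hm)) ≤
      ENNReal.ofReal (√2 * maxSize m * GromovHausdorff.ghDist X Y) := by
  set δ := GromovHausdorff.ghDist X Y with hδ
  let Φ := GromovHausdorff.optimalGHInjl X Y
  let Ψ := GromovHausdorff.optimalGHInjr X Y
  have hΦ : Isometry Φ := GromovHausdorff.isometry_optimalGHInjl X Y
  have hΨ : Isometry Ψ := GromovHausdorff.isometry_optimalGHInjr X Y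
  have hd : Metric.hausdorffDist (Set.range Φ) (Set.range Ψ) = δ :=
    GromovHausdorff.hausdorffDist_optimal
  have hX := isCompact_range hΦ.continuous
  have hY := isCompact_range hΨ.continuous
  have hX' := Set.range_nonempty Φ
  have hY' := Set.range_nonempty Ψ
  -- Compactness makes the Hausdorff distance attained at each point, so `W` projects onto both
  -- factors. This gives injectivity of `ρ` and `σ` with no loss beyond `δ`.
  let W := {p : X × Y // dist (Φ p.1) (Ψ p.2) ≤ δ}
  have hleft : ∀ x, ∃ w : W, w.1.1 = x := by
    intro x
    obtain ⟨_, ⟨y, rfl⟩, h⟩ := exists_dist_le_hausdorffDist hX hY hX' hY' (Set.mem_range_self x)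
    exact ⟨⟨(x, y), h.trans_eq hd⟩, rfl⟩
  have hright : ∀ y, ∃ w : W, w.1.2 = y := by
    intro y
    obtain ⟨_, ⟨x, rfl⟩, h⟩ := exists_dist_le_hausdorffDist hY hX hY' hX' (Set.mem_range_self y)
    rw [Metric.hausdorffDist_comm, hd, dist_comm] at h
    exact ⟨⟨(x, y), h⟩, rfl⟩
  have hWne : Nonempty W := ⟨(hleft (Classical.arbitrary X)).choose⟩
  have hWc : CompactSpace W := by
    refine isCompact_iff_compactSpace.1 (IsClosed.isCompact ?_)
    exact isClosed_le ((hΦ.continuous.comp continuous_fst).dist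
      (hΨ.continuous.comp continuous_snd)) continuous_const
  have hne : ∀ l, Nonempty (Fin (m l)) := fun l => ⟨⟨0, hm l⟩⟩
  let fX : C(W, X) := ⟨fun w => w.1.1, by fun_prop⟩
  let fY : C(W, Y) := ⟨fun w => w.1.2, by fun_prop⟩
  let ρ : C(X, FDAlg m) →⋆ₐ[ℂ] C(W, FDAlg m) := fX.compStarAlgHom' ℂ (FDAlg m)
  let σ : C(Y, FDAlg m) →⋆ₐ[ℂ] C(W, FDAlg m) := fY.compStarAlgHom' ℂ (FDAlg m)
  have hρ : Function.Injective ρ := by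
    intro a b hab
    ext1 x
    obtain ⟨w, rfl⟩ := hleft x
    exact congrArg (fun f : C(W, FDAlg m) => f w) hab
  have hσ : Function.Injective σ := by
    intro a b hab
    ext1 y
    obtain ⟨w, rfl⟩ := hright y
    exact congrArg (fun f : C(W, FDAlg m) => f w) hab
  have hδ0 : 0 ≤ δ := hd ▸ Metric.hausdorffDist_nonneg
  have hedist : ∀ (a : C(X, FDAlg m)) (b : C(Y, FDAlg m)),
      (∀ x y, ‖a x - b y‖ ≤ √2 * maxSize m * dist (Φ x) (Ψ y)) →
      edist (ρ a) (σ b) ≤ ENNReal.ofReal (√2 * maxSize m * δ) := by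
    intro a b h
    rw [edist_dist]
    refine ENNReal.ofReal_le_ofReal ((ContinuousMap.dist_le (by positivity)).2 fun w => ?_)
    rw [dist_eq_norm]
    refine (h w.1.1 w.1.2).trans ?_
    gcongr
    exact w.2
  let γ : Bridge C(X, FDAlg m) C(Y, FDAlg m) := Bridge.ofInjective C(W, FDAlg m) ρ σ hρ hσ
  refine (propinquity_le_bridge_length (P := QLCQMS.of (isQuasiLeibnizCQMS_lipNorm (X := X) hm))
    (Q := QLCQMS.of (isQuasiLeibnizCQMS_lipNorm (X := Y) hm)) γ).trans (max_le ?_ ?_)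
  · refine Bridge.reach_ofInjective_le _ ρ σ hρ hσ (fun a ha => ?_) fun b hb => ?_
    · obtain ⟨b, hb, hab⟩ := exists_lipNorm_le_one_norm_sub_le hΦ hΨ ha
      exact ⟨b, hb, hedist a b hab⟩
    · obtain ⟨a, ha, hab⟩ := exists_lipNorm_le_one_norm_sub_le hΨ hΦ hb
      refine ⟨a, ha, hedist a b fun x y => ?_⟩
      rw [norm_sub_rev, dist_comm]
      exact hab y x
  · exact (Bridge.height_ofInjective _ ρ σ hρ hσ _ _).trans_le bot_le

theorem quantumIsometric_of {A B : Type u} [CStarAlgebra A] [CStarAlgebra B] {C D C' D' : ℝ}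
    {LA : selfAdjoint A → ℝ≥0∞} {LB : selfAdjoint B → ℝ≥0∞} (hA : IsQuasiLeibnizCQMS A C D LA)
    (hB : IsQuasiLeibnizCQMS B C' D' LB) (π : A ≃⋆ₐ[ℂ] B)
    (hπ : ∀ a : selfAdjoint A, LB ⟨π a, IsSelfAdjoint.map a.2 π⟩ = LA a) :
    QuantumIsometric (QLCQMS.of hA) (QLCQMS.of hB) :=
  ⟨π, hπ⟩

/-- Isometric compact metric spaces give quantum isometric spaces. -/
theorem quantumIsometric_of_isometryEquiv (hm : ∀ l, 0 < m l) {X Y : Type u} [MetricSpace X]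
    [CompactSpace X] [Nonempty X] [MetricSpace Y] [CompactSpace Y] [Nonempty Y] (e : X ≃ᵢ Y) :
    QuantumIsometric (QLCQMS.of (isQuasiLeibnizCQMS_lipNorm (X := X) hm))
      (QLCQMS.of (isQuasiLeibnizCQMS_lipNorm (X := Y) hm)) := by
  have hmax : ∀ a : C(X, FDAlg m), max (lipConst (a.comp (e.symm : C(Y, X))))
      (scalarDist (a.comp (e.symm : C(Y, X)))) = max (lipConst a) (scalarDist a) := by
    intro a
    congr 1
    · refine e.symm.toEquiv.iSup_congr fun x => (e.symm.toEquiv.iSup_congr fun y => ?_).symm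
      refine iSup_congr_Prop (by simp) fun _ => ?_
      rw [← e.symm.edist_eq]
      rfl
    · exact iInf_congr fun r => e.symm.toEquiv.iSup_congr fun x => rfl
  refine quantumIsometric_of _ _ (e.toHomeomorph.symm.compStarAlgEquiv' ℂ (FDAlg m)) fun a => ?_
  rw [lipNorm_eq, lipNorm_eq]
  exact hmax a

end GromovHausdorff

end QPropinquity

theorem mainTheorem2 {n : ℕ} (m : Fin (n + 1) → ℕ) (hm : ∀ l, 0 < m l) :
    ∃ hL : ∀ (X : Type u) [MetricSpace X] [CompactSpace X] [Nonempty X],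
        QPropinquity.IsQuasiLeibnizCQMS C(X, QPropinquity.FDAlg m)
          (Real.sqrt 2 * QPropinquity.maxSize m) 0 (QPropinquity.lipNorm m X),
      (∃ Γ : GromovHausdorff.GHSpace → QPropinquity.QLCQMSClass.{u},
        (∀ (X : Type u) [MetricSpace X] [CompactSpace X] [Nonempty X],
          Γ (GromovHausdorff.toGHSpace X) = ⟦QPropinquity.QLCQMS.of (hL X)⟧) ∧
        Continuous Γ) ∧
      ∀ (X Y : Type u) [MetricSpace X] [CompactSpace X] [Nonempty X]
        [MetricSpace Y] [CompactSpace Y] [Nonempty Y],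
        QPropinquity.propinquity (QPropinquity.QLCQMS.of (hL X)) (QPropinquity.QLCQMS.of (hL Y)) ≤
          ENNReal.ofReal
            (Real.sqrt 2 * QPropinquity.maxSize m * GromovHausdorff.ghDist X Y) := by
  -- `Γ` is evaluated on the chosen representative of each class, lifted to universe `u`; isometry
  -- invariance makes the choice immaterial.
  refine ⟨fun X => QPropinquity.isQuasiLeibnizCQMS_lipNorm hm, ⟨fun p =>
    ⟦QPropinquity.QLCQMS.of
      (QPropinquity.isQuasiLeibnizCQMS_lipNorm (X := ULift.{u} p.Rep) hm)⟧, ?_, ?_⟩,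
    QPropinquity.propinquity_le_ghDist hm⟩
  · intro X _ _ _
    have h : GromovHausdorff.toGHSpace (GromovHausdorff.toGHSpace X).Rep =
        GromovHausdorff.toGHSpace X := GromovHausdorff.GHSpace.toGHSpace_rep _
    obtain ⟨e⟩ := GromovHausdorff.toGHSpace_eq_toGHSpace_iff_isometryEquiv.1 h
    exact Quotient.sound (QPropinquity.quantumIsometric_of_isometryEquiv hm
      ((⟨Equiv.ulift, fun _ _ => rfl⟩ : ULift _ ≃ᵢ _).trans e))
  · refine continuous_quot_mk.comp (continuous_def.2 fun U hU => Metric.isOpen_iff.2 fun p hp => ?_)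
    obtain ⟨ε, hε, hball⟩ := hU _ hp
    -- Open sets are defined by propinquity balls, so it is enough that the upper bound tends to `0`
    -- as `q` tends to `p`.
    have htend : Filter.Tendsto (fun q : GromovHausdorff.GHSpace =>
        ENNReal.ofReal (√2 * QPropinquity.maxSize m * dist p q)) (𝓝 p) (𝓝 0) := by
      have : Continuous fun q : GromovHausdorff.GHSpace =>
        ENNReal.ofReal (√2 * QPropinquity.maxSize m * dist p q) :=
        ENNReal.continuous_ofReal.comp (by fun_prop)
      simpa using this.tendsto p
    obtain ⟨δ, hδ, hsub⟩ := Metric.eventually_nhds_iff_ball.1 (htend.eventually_lt_const hε)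
    refine ⟨δ, hδ, fun q hq => hball _ (lt_of_le_of_lt ?_ (hsub q hq))⟩
    refine (QPropinquity.propinquity_le_ghDist hm _ _).trans_eq ?_
    have hdist : GromovHausdorff.ghDist (ULift.{u} p.Rep) (ULift.{u} q.Rep) = dist p q := by
      have hu : ∀ r : GromovHausdorff.GHSpace,
          GromovHausdorff.toGHSpace (ULift.{u} r.Rep) = r := fun r =>
        (GromovHausdorff.toGHSpace_eq_toGHSpace_iff_isometryEquiv.2
          ⟨⟨Equiv.ulift, fun _ _ => rfl⟩⟩).trans r.toGHSpace_rep
      rw [GromovHausdorff.ghDist, hu, hu]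
    rw [hdist]
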